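/- Let $p\ge 1$ and $V=\mathbb{C}^{n_1}\otimes\dots\otimes\mathbb{C}^{n_p}$. Fix inner products $\langle\cdot,\cdot\rangle_i$ on $\mathbb{R}^{n_i}$, extend them to complex bilinear forms on $\mathbb{C}^{n_i}$, and let $\langle\cdot,\cdot\rangle$ be the Bombieri–Weyl bilinear form on $V$, i.e. the bilinear form with $$\langle x_1\otimes\dots\otimes x_p,\;y_1\otimes\dots\otimes y_p\rangle=\prod_{i=1}^p\langle x_i,y_i\rangle_i .$$ All closures below are Zariski closures. For an irreducible variety $Z\subseteq V$ let $Z_{reg}$ be its set of regular points, for $x\in Z_{reg}$ let $N_xZ=(T_xZ)^{\perp}$ be the orthogonal complement of the tangent space with respect to $\langle\cdot,\cdot\rangle$, and put $$\operatorname{Con}(Z)=\overline{\{(x,y)\in V\times V\mid x\in Z_{reg},\ y\in N_xZ\}},\qquad Z^*=\overline{\{y\mid (x,y)\in\operatorname{Con}(Z)\text{ for some }x\}}$$ (the conormal variety and the dual variety of $Z$), and $$\mathcal{E}_{Z}=\overline{\{(x,y,T)\in V^3\mid (x,y)\in\operatorname{Con}(Z),\ T=x+y\}}$$ (the joint ED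 correspondence of $Z$). For $A\subseteq Z$ the data locus of $A$ with respect to $Z$ is the closure of $\{T\mid (x,y,T)\in\mathcal{E}_Z\text{ for some }x\in A,\ y\in V\}$. Let $X\subseteq V$ be the variety of tensors of the form $x_1\otimes\dots\otimes x_p$ (rank at most one), let $X^*$ be its dual variety, and let $\operatorname{DL}_2$ be the data locus of $X\cap X^*$ with respect to $X^*$. Then $$\operatorname{DL}_2=\overline{\{x+y\mid x\in X_{reg}\text{ and }y\in N_xX\cap X\}} .$$ -/

import Mathlib

open scoped TensorProduct

namespace TensorDL

noncomputable section

section AffineGeometry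

variable {V : Type*} [AddCommGroup V] [Module ℂ V]

/-- The algebra of polynomial functions on a complex vector space `V`: the algebra of functions
generated by the linear forms on `V` (that is, by the coordinates, for any choice of basis). -/
def polyFun (V : Type*) [AddCommGroup V] [Module ℂ V] : Subalgebra ℂ (V → ℂ) :=
  Algebra.adjoin ℂ {f : V → ℂ | ∃ φ : Module.Dual ℂ V, f = fun v => φ v}

/-- The ideal of all polynomial functions that vanish on the set `S`. -/
def vanishing (S : Set V) : Ideal (polyFun V) where
  carrier := {f | ∀ v ∈ S, (f : V → ℂ) v = 0}
  add_mem' := by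
    intro f g hf hg v hv
    simp [hf v hv, hg v hv]
  zero_mem' := by
    intro v _
    rfl
  smul_mem' := by
    intro c f hf v hv
    simp [hf v hv]

/-- The Zariski closure of the set `S`. -/
def zariskiClosure (S : Set V) : Set V :=
  {v | ∀ f ∈ vanishing S, (f : V → ℂ) v = 0}

/-- The differential of a polynomial function at a point is a linear form. -/
theorem polyFun_hasLineDerivAt {f : V → ℂ} (hf : f ∈ polyFun V) (x : V) :
    ∃ L : Module.Dual ℂ V, ∀ v, HasLineDerivAt ℂ f (L v) x v := by
  induction hf using Algebra.adjoin_induction with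
  | mem f hf =>
    obtain ⟨φ, rfl⟩ := hf
    refine ⟨φ, fun v => ?_⟩
    have h : HasDerivAt (fun t : ℂ => φ x + t * φ v) (φ v) 0 := by
      simpa using ((hasDerivAt_id (0 : ℂ)).mul_const (φ v)).const_add (φ x)
    simpa [HasLineDerivAt] using h
  | algebraMap r =>
    refine ⟨0, fun v => ?_⟩
    exact hasDerivAt_const (0 : ℂ) r
  | add f g _ _ hf hg =>
    obtain ⟨L, hL⟩ := hf
    obtain ⟨M, hM⟩ := hg
    exact ⟨L + M, fun v => HasDerivAt.add (hL v) (hM v)⟩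
  | mul f g _ _ hf hg =>
    obtain ⟨L, hL⟩ := hf
    obtain ⟨M, hM⟩ := hg
    refine ⟨g x • L + f x • M, fun v => ?_⟩
    have h := HasDerivAt.mul (hL v) (hM v)
    simp only [zero_smul, add_zero] at h
    have e : (g x • L + f x • M) v = L v * g x + f x * M v := by
      simp [mul_comm]
    rw [e]
    exact h

/-- The Zariski tangent space `T_x Z`: all directions `v` such that `d_x f (v) = 0` for every
polynomial function `f` that vanishes on `Z`. -/
def tangentSpace (Z : Set V) (x : V) : Submodule ℂ V where
  carrier := {v | ∀ f ∈ vanishing Z, lineDeriv ℂ (f : V → ℂ) x v = 0}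
  add_mem' := by
    intro v w hv hw f hf
    obtain ⟨L, hL⟩ := polyFun_hasLineDerivAt f.2 x
    have h1 := hv f hf
    have h2 := hw f hf
    rw [(hL _).lineDeriv] at h1 h2 ⊢
    rw [map_add, h1, h2, add_zero]
  zero_mem' := by
    intro f _
    exact lineDeriv_zero
  smul_mem' := by
    intro c v hv f hf
    obtain ⟨L, hL⟩ := polyFun_hasLineDerivAt f.2 x
    have h1 := hv f hf
    rw [(hL _).lineDeriv] at h1 ⊢
    rw [map_smul, h1, smul_zero]

/-- The dimension of a variety `Z`: the transcendence degree over `ℂ` of its coordinate ring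
(for irreducible `Z` this is the transcendence degree of its function field). -/
def dimVariety (Z : Set V) : Cardinal :=
  Algebra.trdeg ℂ (polyFun V ⧸ vanishing Z)

/-- The set `Z_reg` of regular points of an irreducible variety `Z`: the points of `Z` at which
the Zariski tangent space has the dimension of `Z`. -/
def regularPoints (Z : Set V) : Set V :=
  {x | x ∈ Z ∧ Module.rank ℂ (tangentSpace Z x) = dimVariety Z}

/-- The normal space `N_x Z`: the orthogonal complement of `T_x Z` for the bilinear form `B`. -/
def normalSpace (B : LinearMap.BilinForm ℂ V) (Z : Set V) (x : V) : Submodule ℂ V :=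
  B.orthogonal (tangentSpace Z x)

/-- The conormal variety `Con(Z)`. -/
def conormal (B : LinearMap.BilinForm ℂ V) (Z : Set V) : Set (V × V) :=
  zariskiClosure {q : V × V | q.1 ∈ regularPoints Z ∧ q.2 ∈ normalSpace B Z q.1}

/-- The dual variety `Z*`, inside the same space `V`. -/
def dualVariety (B : LinearMap.BilinForm ℂ V) (Z : Set V) : Set V :=
  zariskiClosure (Prod.snd '' conormal B Z)

/-- The joint ED correspondence of the distance optimization problem on `Z`: the closure of the
set of triples `(x, y, T)` with `(x, y) ∈ Con(Z)` and `T = x + y`. -/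
def jointED (B : LinearMap.BilinForm ℂ V) (Z : Set V) : Set (V × V × V) :=
  zariskiClosure {t : V × V × V | (t.1, t.2.1) ∈ conormal B Z ∧ t.2.2 = t.1 + t.2.1}

/-- The data locus of a subvariety `A` of a variety `Z`: the closure of the projection to the
space of data points `T` of the part of the joint ED correspondence of `Z` over `A`. -/
def dataLocus (B : LinearMap.BilinForm ℂ V) (Z A : Set V) : Set V :=
  zariskiClosure ((fun t : V × V × V => t.2.2) '' (jointED B Z ∩ {t | t.1 ∈ A}))

end AffineGeometry

section Tensors

variable {p : ℕ} (n : Fin p → ℕ)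

/-- The space of tensors `ℂ^{n_1} ⊗ … ⊗ ℂ^{n_p}`. -/
abbrev TensorSpace : Type := ⨂[ℂ] i : Fin p, (Fin (n i) → ℂ)

/-- The variety `X` of tensors of rank at most one. -/
def rankOne : Set (TensorSpace n) :=
  Set.range fun v : (i : Fin p) → Fin (n i) → ℂ => PiTensorProduct.tprod ℂ v

variable {n}

/-- The Bombieri-Weyl bilinear form on `ℂ^{n_1} ⊗ … ⊗ ℂ^{n_p}` attached to inner products on the
spaces `ℝ^{n_i}`, given by their Gram matrices `G i` and extended bilinearly to `ℂ^{n_i}`. -/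
def bwForm (G : (i : Fin p) → Matrix (Fin (n i)) (Fin (n i)) ℝ) :
    LinearMap.BilinForm ℂ (TensorSpace n) :=
  PiTensorProduct.dualDistrib ∘ₗ
    PiTensorProduct.map fun i => Matrix.toBilin' ((G i).map Complex.ofReal)

/-- The defining property: the form is multiplicative on rank-one tensors. -/
theorem bwForm_tprod (G : (i : Fin p) → Matrix (Fin (n i)) (Fin (n i)) ℝ)
    (x y : (i : Fin p) → Fin (n i) → ℂ) :
    bwForm G (PiTensorProduct.tprod ℂ x) (PiTensorProduct.tprod ℂ y) =
      ∏ i, ∑ a, ∑ b, x i a * (G i a b : ℂ) * y i b := by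
  simp [bwForm, PiTensorProduct.dualDistrib_apply, Matrix.toBilin'_apply]

/-- The first special data locus `DL_2`: the data locus of the subvariety `X ∩ X*` of the dual
variety `X*`, for the distance optimization problem on `X*`. -/
def DL2 (G : (i : Fin p) → Matrix (Fin (n i)) (Fin (n i)) ℝ) : Set (TensorSpace n) :=
  dataLocus (bwForm G) (dualVariety (bwForm G) (rankOne n))
    (rankOne n ∩ dualVariety (bwForm G) (rankOne n))

end Tensors

end

end TensorDL

/-! The engine is biduality: for an irreducible cone `Z`, `Con(Z*)` is `Con(Z)` with its factors
exchanged (`mem_conormal_dualVariety_iff`). So the points of the joint ED correspondence of `X*`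
over `X ∩ X*` are the `(x, y, x + y)` with `(y, x) ∈ Con(X)` and `x ∈ X ∩ X*`, and then `y ∈ X`
because `X` is closed. As `X` is regular outside the origin (`mem_regularPoints_rankOne`), `y ≠ 0`
forces `x ∈ N_y X`, and `y + x` has the required form. If `y = 0`, then `T = x` is a regular point
plus the normal vector `0`, or `T = 0`, which lies in the closure. `dataLocus_dualVariety` does this
for every closed irreducible cone regular outside the origin.

Biduality is proved at generic points. `Con(Z)` has a generic point `(x, y)` over a field `L`: `x`
is generic on `Z`, and `y` combines a basis of the gradients at `x` with indeterminate coefficients.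
Its transcendence degree is `dim Z + codim Z = dim V`. If `x` were not normal to `Z*` at `y`, some
derivation `D` of `L` would satisfy `x · Dy ≠ 0`. But `Dx · y = 0` because `y` is normal to `Z`, and
`x · y = 0` by Euler's relation on a cone, so applying `D` gives `x · Dy = 0`. Hence the exchanged
`Con(Z)` lies in `Con(Z*)`; both are irreducible of dimension `dim V`, so they agree.

The count rests on characteristic zero: derivations of a function field form a space of dimension
the transcendence degree, so the gradients have rank `codim Z` at the generic point. Nonvanishing
determinants carry ranks between the generic point and closed points. -/

namespace TensorDL

open MvPolynomial
open scoped TensorProduct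

/-! ### Derivations of fields in characteristic zero -/

section Derivations

open scoped IntermediateField.algebraAdjoinAdjoin

/-- A derivation from a domain of characteristic zero to a field containing it extends to
the field. -/
theorem exists_derivation_extension {k A L : Type*} [CommRing k] [CommRing A]
    [IsDomain A] [Algebra k A] [Field L] [CharZero L] [Algebra k L] [Algebra A L]
    [IsScalarTower k A L] [FaithfulSMul A L] (d : Derivation k A L) :
    ∃ D : Derivation k L L, ∀ a, D (algebraMap A L a) = d a := by
  have hinj := FaithfulSMul.algebraMap_injective A L
  let F := FractionRing A
  let _ : Algebra F L := FractionRing.liftAlgebra A L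
  have : IsScalarTower A F L := FractionRing.isScalarTower_liftAlgebra A L
  have : CharZero F := (algebraMap F L).charZero_iff (algebraMap F L).injective |>.2 inferInstance
  obtain ⟨s, hs⟩ := exists_isTranscendenceBasis F L
  have h1 := hs.isAlgebraic_field
  have : Algebra.FormallySmooth F L := .of_algebraicIndependent_of_isSeparable hs.1
  have : Algebra.FormallyEtale A F := .of_isLocalization (nonZeroDivisors A)
  have : Algebra.FormallySmooth A L := .comp A F L
  -- Formal smoothness of `L` over `A` makes `H1Cotangent` vanish, so `L ⊗ Ω[A⁄k] → Ω[L⁄k]` is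
  -- injective; a linear left inverse then extends `d`.
  have hker : LinearMap.ker (KaehlerDifferential.mapBaseChange k A L) = ⊥ := by
    rw [LinearMap.ker_eq_bot']
    intro x hx
    obtain ⟨x, rfl⟩ := (Algebra.H1Cotangent.exact_δ_mapBaseChange k A L x).mp hx
    rw [Subsingleton.elim x 0, map_zero]
  obtain ⟨g, hg⟩ := LinearMap.exists_leftInverse_of_injective _ hker
  let u : TensorProduct A L (Ω[A⁄k]) →ₗ[L] L :=
    LinearMap.liftBaseChange L d.liftKaehlerDifferential
  refine ⟨(u ∘ₗ g).compDer (KaehlerDifferential.D k L), fun a => ?_⟩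
  have h2 := LinearMap.congr_fun hg (1 ⊗ₜ[A] KaehlerDifferential.D k A a)
  simp only [LinearMap.comp_apply, KaehlerDifferential.mapBaseChange_tmul, one_smul,
    KaehlerDifferential.map_D, LinearMap.id_apply] at h2
  simp [u, h2]

/-- In characteristic zero the space of derivations of a field of finite transcendence degree has
the dimension of the transcendence degree. -/
theorem finrank_derivation {k K : Type*} [Field k] [Field K] [CharZero K]
    [Algebra k K] (h : Algebra.trdeg k K < Cardinal.aleph0) :
    Module.finrank K (Derivation k K K) = (Algebra.trdeg k K).toNat := by
  have : CharZero k := (algebraMap k K).charZero_iff (algebraMap k K).injective |>.2 inferInstance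
  obtain ⟨s, hs⟩ := exists_isTranscendenceBasis k K
  have hcard := hs.cardinalMk_eq_trdeg
  have hfin : Finite s := by
    rw [← Cardinal.lt_aleph0_iff_finite, hcard]; exact h
  cases nonempty_fintype s
  have h1 := hs.isAlgebraic_field
  -- `K` is formally étale over the polynomial ring on a transcendence basis, so the differentials
  -- of the basis elements form a basis of `Ω[K⁄k]`.
  let T := MvPolynomial s k
  let A := Algebra.adjoin k (Set.range (Subtype.val : s → K))
  let M := IntermediateField.adjoin k (Set.range (Subtype.val : s → K))
  have e1 : Algebra.FormallyEtale A M := .of_isLocalization (nonZeroDivisors A)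
  have e2 : Algebra.FormallyEtale M K := .of_isSeparable _ _
  have e3 : Algebra.FormallyEtale A K := .comp A M K
  let _ : Algebra T K := (aeval (Subtype.val : s → K)).toAlgebra
  have : IsScalarTower k T K := .of_algHom (aeval (Subtype.val : s → K))
  let _ : Algebra T A := (hs.1.aevalEquiv : T →+* A).toAlgebra
  have : IsScalarTower T A K := .of_algebraMap_eq fun x => by
    change aeval _ x = ((hs.1.aevalEquiv x : A) : K)
    simp
  have e4 : Algebra.FormallyEtale T A := .of_equiv
    { hs.1.aevalEquiv with commutes' := fun _ => rfl }
  have e5 : Algebra.FormallyEtale T K := .comp T A K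
  have e6 : Module.finrank K (Derivation k K K) = Module.finrank K (Ω[K⁄k] →ₗ[K] K) :=
    (KaehlerDifferential.linearMapEquivDerivation k K (M := K)).symm.finrank_eq
  have e7 : Module.finrank K (Ω[K⁄k] →ₗ[K] K) = Module.finrank K (Ω[K⁄k]) :=
    Subspace.dual_finrank_eq
  rw [e6, e7, ← (KaehlerDifferential.tensorKaehlerEquivOfFormallyEtale k T K).finrank_eq,
    Module.finrank_baseChange,
    Module.finrank_eq_card_basis (KaehlerDifferential.mvPolynomialBasis k s), ← hcard,
    Cardinal.mk_toNat_eq_card]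

end Derivations

/-! ### Gradients, tangent vectors and the dimension formula -/

section TangentVectors

variable {k ι : Type*} [Field k]

/-- The gradient of a polynomial. -/
noncomputable def grad (f : MvPolynomial ι k) : ι → MvPolynomial ι k := fun i => pderiv i f

/-- The gradients at the point `x` of the elements of an ideal. -/
def gradSet {L : Type*} [Field L] [Algebra k L] (p : Ideal (MvPolynomial ι k)) (x : ι → L) :
    Set (ι → L) :=
  {w | ∃ f ∈ p, w = fun i => aeval x (grad f i)}

theorem derivation_aeval [Fintype ι] {L : Type*} [Field L] [Algebra k L] (D : Derivation k L L) (x : ι → L)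
    (f : MvPolynomial ι k) :
    D (aeval x f) = ∑ i, D (x i) * aeval x (grad f i) := by
  classical
  induction f using MvPolynomial.induction_on with
  | C a => simp [grad]
  | add f g hf hg => simp [grad, hf, hg, mul_add, Finset.sum_add_distrib] at *
  | mul_X f j hf =>
    simp only [grad] at hf
    simp only [grad, map_mul, aeval_X, Derivation.leibniz, smul_eq_mul, hf, pderiv_X, map_add,
      mul_add, Finset.sum_add_distrib, Pi.single_apply, Finset.mul_sum]
    congr 1
    · simp [mul_comm]
    · exact Finset.sum_congr rfl fun i _ => by ring

/-- A vector orthogonal to the gradients of all relations between the coordinates of a point is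
the vector of values of a derivation at these coordinates. -/
theorem exists_derivation_of_orthogonal [Fintype ι] {L : Type*} [Field L] [CharZero L] [Algebra k L]
    (p : Ideal (MvPolynomial ι k)) (x : ι → L) (hx : ∀ f, aeval x f = 0 → f ∈ p) (v : ι → L)
    (hv : ∀ w ∈ gradSet p x, v ⬝ᵥ w = 0) :
    ∃ D : Derivation k L L, ∀ i, D (x i) = v i := by
  classical
  let Δ : MvPolynomial ι k →ₗ[k] L :=
    ∑ i, (LinearMap.mulLeft k (v i)) ∘ₗ (aeval x).toLinearMap ∘ₗ (pderiv i).toLinearMap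
  have hΔ : ∀ f, Δ f = ∑ i, v i * aeval x (grad f i) := fun f => by simp [Δ, grad]
  let φ := (aeval x : MvPolynomial ι k →ₐ[k] L).rangeRestrict
  have hφ : Function.Surjective φ := AlgHom.rangeRestrict_surjective _
  have hφv : ∀ f, ((φ f : (aeval x : MvPolynomial ι k →ₐ[k] L).range) : L) = aeval x f :=
    fun f => rfl
  -- `Δ f = v · ∇f(x)` descends to the ring `k[x]`: relations between the coordinates lie in `p`,
  -- and `v` kills their gradients.
  have hker : LinearMap.ker φ.toLinearMap ≤ LinearMap.ker Δ := fun f hf => by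
    have h0 : aeval x f = 0 := by
      rw [← hφv]; simpa using hf
    rw [LinearMap.mem_ker, hΔ]
    exact hv _ ⟨f, hx f h0, rfl⟩
  let δ : (aeval x : MvPolynomial ι k →ₐ[k] L).range →ₗ[k] L :=
    (LinearMap.ker φ.toLinearMap).liftQ Δ hker ∘ₗ
      (φ.toLinearMap.quotKerEquivOfSurjective hφ).symm.toLinearMap
  have hδ : ∀ f, δ (φ f) = Δ f := fun f => by
    have : (φ.toLinearMap.quotKerEquivOfSurjective hφ).symm (φ f) =
        (LinearMap.ker φ.toLinearMap).mkQ f := by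
      rw [LinearEquiv.symm_apply_eq]; rfl
    simp [δ, this]
  let d : Derivation k (aeval x : MvPolynomial ι k →ₐ[k] L).range L := Derivation.mk' δ (by
    intro a b
    obtain ⟨f, rfl⟩ := hφ a
    obtain ⟨g, rfl⟩ := hφ b
    rw [← map_mul, hδ, hδ, hδ, hΔ, hΔ, hΔ]
    simp only [Subalgebra.smul_def, hφv, smul_eq_mul, Finset.mul_sum, grad, Derivation.leibniz,
      map_add, map_mul, ← Finset.sum_add_distrib]
    exact Finset.sum_congr rfl fun i _ => by ring)
  obtain ⟨D, hD⟩ := exists_derivation_extension d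
  refine ⟨D, fun i => ?_⟩
  have h1 := hD (φ (X i))
  have h2 : d (φ (X i)) = v i := by
    change δ _ = _
    rw [hδ, hΔ]
    simp [grad, pderiv_X, Pi.single_apply]
  rw [h2] at h1
  rw [← h1]
  congr 1
  exact (aeval_X x i).symm

/-- The dimension formula: at the generic point of an irreducible variety the gradients span a
space complementary in dimension to the variety. -/
theorem finrank_span_gradSet_generic [Fintype ι] [CharZero k] {K : Type*} [Field K] [Algebra k K]
    (p : Ideal (MvPolynomial ι k)) (x : ι → K) (hx : ∀ f, aeval x f = 0 ↔ f ∈ p)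
    (hK : IntermediateField.adjoin k (Set.range x) = ⊤)
    (h : Algebra.trdeg k K < Cardinal.aleph0) :
    Module.finrank K (Submodule.span K (gradSet p x)) + (Algebra.trdeg k K).toNat =
      Fintype.card ι := by
  classical
  have : CharZero K := (algebraMap k K).charZero_iff (algebraMap k K).injective |>.1 inferInstance
  let N := Submodule.span K (gradSet p x)
  let e : Derivation k K K →ₗ[K] (ι → K) :=
    { toFun := fun D i => D (x i), map_add' := fun _ _ => rfl, map_smul' := fun _ _ => rfl }
  have he : Function.Injective e := by
    rw [injective_iff_map_eq_zero]
    intro D hD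
    have hD' : ∀ i, D (x i) = 0 := fun i => congr_fun hD i
    ext a
    have ha : a ∈ IntermediateField.adjoin k (Set.range x) := hK ▸ trivial
    induction ha using IntermediateField.adjoin_induction with
    | mem a ha => obtain ⟨i, rfl⟩ := ha; exact hD' i
    | algebraMap a => simp
    | add a b _ _ ha hb => simpa [ha] using hb
    | inv a _ ha => simp only [Derivation.zero_apply] at ha; simp [Derivation.leibniz_inv, ha]
    | mul a b _ _ ha hb =>
      simp only [Derivation.zero_apply] at ha hb; simp [ha, hb]
  let Bf : LinearMap.BilinForm K (ι → K) := Matrix.toBilin' 1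
  have hBf : ∀ v w, Bf v w = v ⬝ᵥ w := fun v w => by simp [Bf, Matrix.toBilin'_apply']
  have hnd : Bf.Nondegenerate := 
    LinearMap.BilinForm.nondegenerate_toBilin'_of_det_ne_zero' 1 (by simp)
  -- Derivations of `K` are determined by their values on the generators `x i`, and the value
  -- vectors that occur are exactly those orthogonal to the gradients.
  have hr : LinearMap.range e = Bf.orthogonal N := by
    ext v
    rw [LinearMap.BilinForm.mem_orthogonal_iff]
    constructor
    · rintro ⟨D, rfl⟩ w hw
      change Bf w _ = 0
      rw [hBf, dotProduct_comm]
      induction hw using Submodule.span_induction with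
      | mem w hw =>
        obtain ⟨f, hf, rfl⟩ := hw
        have := derivation_aeval D x f
        rw [(hx f).2 hf, map_zero] at this
        exact this.symm
      | zero => simp
      | add a b _ _ ha hb => rw [dotProduct_add, ha, hb, add_zero]
      | smul c a _ ha => rw [dotProduct_smul, ha, smul_zero]
    · intro hv
      obtain ⟨D, hD⟩ := exists_derivation_of_orthogonal p x (fun f => (hx f).1) v fun w hw => by
        rw [dotProduct_comm, ← hBf]; exact hv w (Submodule.subset_span hw)
      exact ⟨D, funext hD⟩
  have h1 := LinearMap.BilinForm.finrank_orthogonal hnd N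
  rw [← hr, LinearMap.finrank_range_of_inj he, finrank_derivation h, Module.finrank_fintype_fun_eq_card]
    at h1
  have h2 := Submodule.finrank_le N
  rw [Module.finrank_fintype_fun_eq_card] at h2
  change Module.finrank K N + _ = _
  omega

end TangentVectors

/-! ### Surjections and transcendence degree -/

section TranscendenceDegree

/-- A surjection between domains that does not decrease the transcendence degree is injective. -/
theorem injective_of_surjective_of_trdeg_le {k A B : Type*} [Field k] [CommRing A] [IsDomain A]
    [CommRing B] [IsDomain B] [Algebra k A] [Algebra k B] (f : A →ₐ[k] B)
    (hf : Function.Surjective f) (hfin : Algebra.trdeg k A < Cardinal.aleph0)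
    (h : (Algebra.trdeg k A).toNat ≤ (Algebra.trdeg k B).toNat) : Function.Injective f := by
  obtain ⟨s, hs⟩ := exists_isTranscendenceBasis k B
  choose y hy using fun i : s => hf i
  have hfy : f ∘ y = Subtype.val := funext hy
  have hyi : AlgebraicIndependent k y := .of_comp f (by rw [hfy]; exact hs.1)
  have hB : Algebra.trdeg k B < Cardinal.aleph0 :=
    Cardinal.lift_lt_aleph0.1 ((lift_trdeg_le_of_surjective f hf).trans_lt
      (Cardinal.lift_lt_aleph0.2 hfin))
  have hb : IsTranscendenceBasis k y := by
    refine hyi.isTranscendenceBasis_of_lift_trdeg_le hfin ?_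
    rw [hs.cardinalMk_eq_trdeg, ← Cardinal.cast_toNat_of_lt_aleph0 hfin,
      ← Cardinal.cast_toNat_of_lt_aleph0 hB]
    simpa using h
  have := hb.isAlgebraic
  rw [injective_iff_map_eq_zero]
  intro a ha
  by_contra ha0
  -- A nonzero `a` in the kernel divides a nonzero polynomial in the lifted basis `y`; its image
  -- would be an algebraic relation in the basis `s` of `B`.
  obtain ⟨t, ht0, b, hb⟩ := IsAlgebraic.exists_nonzero_dvd
    (R := Algebra.adjoin k (Set.range y)) (Algebra.IsAlgebraic.isAlgebraic a)
    (mem_nonZeroDivisors_of_ne_zero ha0)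
  obtain ⟨F, rfl⟩ := hyi.aevalEquiv.surjective t
  have h1 : f (aeval y F) = 0 := by
    have : aeval y F = a * b := by rw [← hb]; simp
    rw [this, map_mul, ha, zero_mul]
  have h2 : aeval (Subtype.val : s → B) F = 0 := by
    rw [← hfy, ← h1]; exact congr_arg (fun φ => φ F) (comp_aeval y f).symm
  have h3 : F = 0 := by
    have := hs.1
    rw [algebraicIndependent_iff] at this
    exact this F h2
  exact ht0 (by rw [h3, map_zero])

end TranscendenceDegree

/-! ### Linear independence as nonvanishing of a polynomial -/

section LinearIndependence

variable {k σ ι κ : Type*} [Field k] [Fintype ι] [Fintype κ] [DecidableEq κ]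

/-- A family of polynomial vectors that is independent at a point of which the coordinates
generate the base field is independent wherever some minor-like determinant does not vanish. -/
theorem exists_det_ne_zero_of_linearIndependent {K : Type*} [Field K] [Algebra k K]
    (w : Matrix κ ι (MvPolynomial σ k)) (x : σ → K)
    (hK : ∀ a : K, ∃ f g : MvPolynomial σ k, aeval x g ≠ 0 ∧ a * aeval x g = aeval x f)
    (h : LinearIndependent K fun j i => aeval x (w j i)) :
    ∃ M : Matrix ι κ (MvPolynomial σ k), aeval x (w * M).det ≠ 0 := by
  classical
  let V : Matrix κ ι K := w.map (aeval x)
  have hinj : Function.Injective V.vecMul := Matrix.vecMul_injective_iff.2 h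
  obtain ⟨g, hg⟩ := LinearMap.exists_leftInverse_of_injective V.vecMulLinear
    (LinearMap.ker_eq_bot.2 hinj)
  let A : Matrix ι κ K := Matrix.of fun i j => g (Pi.single i 1) j
  have hVA : V * A = 1 := by
    ext a b
    have h1 := congr_fun (LinearMap.congr_fun hg (Pi.single a 1)) b
    have h2 : V.vecMulLinear (Pi.single a 1) = ∑ i, V a i • (Pi.single i 1 : ι → K) := by
      ext i; simp [Matrix.vecMulLinear, Finset.sum_apply, Pi.single_apply]
    rw [LinearMap.comp_apply, h2, map_sum] at h1
    simp only [map_smul, Finset.sum_apply, Pi.smul_apply, smul_eq_mul, LinearMap.id_apply] at h1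
    rw [Matrix.mul_apply, Matrix.one_apply]
    simp only [A, Matrix.of_apply]
    rw [h1, Pi.single_apply]
    simp [eq_comm]
  choose num den hden hnum using fun i j => hK (A i j)
  -- The right inverse `A` of `V` with denominators cleared: every entry is scaled by the same
  -- product of all the `den`.
  let M : Matrix ι κ (MvPolynomial σ k) := Matrix.of fun i j =>
    num i j * ∏ q ∈ Finset.univ.erase (i, j), den q.1 q.2
  have hM : M.map (aeval x) = (∏ q : ι × κ, aeval x (den q.1 q.2)) • A := by
    ext i j
    simp only [M, Matrix.map_apply, Matrix.of_apply, map_mul, map_prod, Matrix.smul_apply, smul_eq_mul]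
    rw [← hnum, ← Finset.mul_prod_erase _ _ (Finset.mem_univ (i, j))]
    ring
  refine ⟨M, ?_⟩
  have hwM : (w * M).map (aeval x) = V * M.map (aeval x) := Matrix.map_mul
  rw [AlgHom.map_det, AlgHom.mapMatrix_apply, hwM, hM, Matrix.mul_smul, hVA, Matrix.det_smul, Matrix.det_one, mul_one]
  exact pow_ne_zero _ (Finset.prod_ne_zero_iff.2 fun q _ => hden _ _)

/-- With the preceding criterion this transports independence between points: a determinant is found
at one point and tested at another, possibly over another field. -/
theorem linearIndependent_of_det_ne_zero {F : Type*} [Field F] [Algebra k F]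
    (w : Matrix κ ι (MvPolynomial σ k)) (M : Matrix ι κ (MvPolynomial σ k)) (y : σ → F)
    (h : aeval y (w * M).det ≠ 0) : LinearIndependent F fun j i => aeval y (w j i) := by
  rw [AlgHom.map_det, AlgHom.mapMatrix_apply, Matrix.map_mul] at h
  have h1 := Matrix.linearIndependent_rows_of_det_ne_zero h
  have h2 : (fun i => (w.map (aeval y) * M.map (aeval y)) i) =
      (M.map (aeval y)).vecMulLinear ∘ fun j i => aeval y (w j i) := by
    ext a b
    simp [Matrix.mul_apply, Matrix.vecMul, dotProduct]
  rw [h2] at h1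
  exact h1.of_comp

end LinearIndependence

/-! ### The conormal ideal -/

section ConormalIdeal

variable {k ι : Type*} [Field k]

/-- The module of polynomial vectors generated by the gradients of the elements of an ideal. -/
noncomputable def gradModule (p : Ideal (MvPolynomial ι k)) :
    Submodule (MvPolynomial ι k) (ι → MvPolynomial ι k) :=
  Submodule.span _ (grad '' (p : Set (MvPolynomial ι k)))

/-- The ideal of the conormal variety of the variety of `p`. -/
noncomputable def conormalIdeal (p : Ideal (MvPolynomial ι k)) :
    Ideal (MvPolynomial (ι ⊕ ι) k) where
  carrier := {F | ∀ w ∈ gradModule p, aeval (Sum.elim X w) F ∈ p}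
  add_mem' := fun hF hG w hw => by rw [map_add]; exact p.add_mem (hF w hw) (hG w hw)
  zero_mem' := fun w _ => by rw [map_zero]; exact p.zero_mem
  smul_mem' := fun c F hF w hw => by
    rw [smul_eq_mul, map_mul]; exact p.mul_mem_left _ (hF w hw)

variable {L : Type*} [Field L] [Algebra k L]

theorem aeval_aeval_sumElim (x : ι → L) (w : ι → MvPolynomial ι k) (F : MvPolynomial (ι ⊕ ι) k) :
    aeval x (aeval (Sum.elim X w) F) = aeval (Sum.elim x fun i => aeval x (w i)) F := by
  have : (aeval x).comp (aeval (Sum.elim X w)) =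
      (aeval (Sum.elim x fun i => aeval x (w i)) : MvPolynomial (ι ⊕ ι) k →ₐ[k] L) := by
    ext i
    cases i <;> simp
  exact DFunLike.congr_fun this F

theorem aeval_mem_span_of_mem_gradModule {p : Ideal (MvPolynomial ι k)} (x : ι → L)
    {w : ι → MvPolynomial ι k} (hw : w ∈ gradModule p) :
    (fun i => aeval x (w i)) ∈ Submodule.span L (gradSet p x) := by
  induction hw using Submodule.span_induction with
  | mem w hw =>
    obtain ⟨f, hf, rfl⟩ := hw
    exact Submodule.subset_span ⟨f, hf, rfl⟩
  | zero => simp only [Pi.zero_apply, map_zero]; exact Submodule.zero_mem _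
  | add a b _ _ ha hb => simp only [Pi.add_apply, map_add]; exact Submodule.add_mem _ ha hb
  | smul c a _ ha =>
    simp only [Pi.smul_apply, smul_eq_mul, map_mul]
    exact Submodule.smul_mem _ (aeval x c) ha

/-- Scalars from `k` lift to constant polynomials. Scalars from `L` need not, hence the restriction
to the `k`-span, removed by `aeval_eq_zero_on_span`. -/
theorem exists_mem_gradModule_of_mem_span {p : Ideal (MvPolynomial ι k)} (x : ι → L)
    {y : ι → L} (hy : y ∈ Submodule.span k (gradSet p x)) :
    ∃ w ∈ gradModule p, y = fun i => aeval x (w i) := by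
  induction hy using Submodule.span_induction with
  | mem w hw =>
    obtain ⟨f, hf, rfl⟩ := hw
    exact ⟨grad f, Submodule.subset_span ⟨f, hf, rfl⟩, rfl⟩
  | zero => exact ⟨0, Submodule.zero_mem _, by ext; simp⟩
  | add a b _ _ ha hb =>
    obtain ⟨v, hv, rfl⟩ := ha
    obtain ⟨w, hw, rfl⟩ := hb
    exact ⟨v + w, Submodule.add_mem _ hv hw, by ext; simp⟩
  | smul c a _ ha =>
    obtain ⟨v, hv, rfl⟩ := ha
    exact ⟨(C c : MvPolynomial ι k) • v, Submodule.smul_mem _ _ hv, by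
      ext; simp [Algebra.smul_def]⟩

/-- A polynomial that vanishes on the span of a set over an infinite field vanishes on its span
over any larger field. -/
theorem aeval_eq_zero_on_span [Infinite k] {τ : Type*} (F : MvPolynomial (τ ⊕ ι) k) (a : τ → L)
    (S : Set (ι → L)) (h : ∀ y ∈ Submodule.span k S, aeval (Sum.elim a y) F = 0)
    {y : ι → L} (hy : y ∈ Submodule.span L S) : aeval (Sum.elim a y) F = 0 := by
  obtain ⟨n, c, g, rfl⟩ := Submodule.mem_span_set'.1 hy
  -- The value of `F` as a polynomial in the coefficients of the combination. It vanishes at all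
  -- coefficients from the infinite field `k`, so it is zero.
  let G : MvPolynomial (Fin n) L :=
    aeval (Sum.elim (fun t => C (a t)) fun i => ∑ j, X j * C ((g j : ι → L) i)) F
  have hG : ∀ c : Fin n → L, eval c G = aeval (Sum.elim a (∑ j, c j • (g j : ι → L))) F := by
    intro c
    have : ((aeval c : MvPolynomial (Fin n) L →ₐ[L] L).restrictScalars k).comp
        (aeval (Sum.elim (fun t => C (a t)) fun i => ∑ j, X j * C ((g j : ι → L) i))) =
        (aeval (Sum.elim a (∑ j, c j • (g j : ι → L))) : MvPolynomial (τ ⊕ ι) k →ₐ[k] L) := by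
      ext i
      cases i <;> simp [Finset.sum_apply]
    rw [← coe_aeval_eq_eval]
    exact DFunLike.congr_fun this F
  have h0 : G = 0 := by
    refine funext_set (fun _ => Set.range (algebraMap k L))
      (fun _ => Set.infinite_range_of_injective (algebraMap k L).injective) fun c hc => ?_
    choose b hb using fun i => hc i trivial
    rw [hG, map_zero]
    refine h _ (Submodule.sum_mem _ fun j _ => ?_)
    rw [← hb j, algebraMap_smul]
    exact Submodule.smul_mem _ _ (Submodule.subset_span (g j).2)
  rw [← hG, h0, map_zero]

end ConormalIdeal

/-! ### Generic points and the rank of the gradients -/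

section GenericPoint

universe u
variable {k ι : Type u} [Field k] (p : Ideal (MvPolynomial ι k))

/-- The function field of the variety of a prime ideal. -/
abbrev FunctionField : Type u := FractionRing (MvPolynomial ι k ⧸ p)

/-- The generic point of the variety of a prime ideal. -/
noncomputable def genericPoint : ι → FunctionField p :=
  fun i => algebraMap (MvPolynomial ι k ⧸ p) (FunctionField p) (Ideal.Quotient.mk p (X i))

theorem aeval_genericPoint (f : MvPolynomial ι k) :
    aeval (genericPoint p) f =
      algebraMap (MvPolynomial ι k ⧸ p) (FunctionField p) (Ideal.Quotient.mk p f) := by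
  have : aeval (genericPoint p) =
      (IsScalarTower.toAlgHom k (MvPolynomial ι k ⧸ p) (FunctionField p)).comp
        (Ideal.Quotient.mkₐ k p) := by
    ext i; simp [genericPoint]
  rw [this]; rfl

variable [p.IsPrime]

theorem aeval_genericPoint_eq_zero {f : MvPolynomial ι k} :
    aeval (genericPoint p) f = 0 ↔ f ∈ p := by
  rw [aeval_genericPoint, FaithfulSMul.algebraMap_eq_zero_iff, Ideal.Quotient.eq_zero_iff_mem]

theorem exists_mul_aeval_genericPoint (a : FunctionField p) :
    ∃ f g : MvPolynomial ι k, aeval (genericPoint p) g ≠ 0 ∧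
      a * aeval (genericPoint p) g = aeval (genericPoint p) f := by
  obtain ⟨x, y, hy, rfl⟩ := IsFractionRing.div_surjective (A := MvPolynomial ι k ⧸ p) a
  obtain ⟨f, rfl⟩ := Ideal.Quotient.mk_surjective x
  obtain ⟨g, rfl⟩ := Ideal.Quotient.mk_surjective y
  have hg : aeval (genericPoint p) g ≠ 0 := by
    rw [aeval_genericPoint]
    exact IsFractionRing.to_map_ne_zero_of_mem_nonZeroDivisors hy
  refine ⟨f, g, hg, ?_⟩
  rw [aeval_genericPoint] at hg ⊢
  rw [aeval_genericPoint, div_mul_cancel₀ _ hg]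

theorem adjoin_genericPoint :
    IntermediateField.adjoin k (Set.range (genericPoint p)) = ⊤ := by
  rw [eq_top_iff]
  intro a _
  obtain ⟨f, g, hg, h⟩ := exists_mul_aeval_genericPoint p a
  have hmem : ∀ f : MvPolynomial ι k, aeval (genericPoint p) f ∈
      IntermediateField.adjoin k (Set.range (genericPoint p)) := fun f => by
    have : aeval (genericPoint p) f ∈ Algebra.adjoin k (Set.range (genericPoint p)) := by
      rw [Algebra.adjoin_range_eq_range_aeval]; exact ⟨f, rfl⟩
    exact IntermediateField.algebra_adjoin_le_adjoin _ _ this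
  rw [show a = aeval (genericPoint p) f / aeval (genericPoint p) g from
    eq_div_of_mul_eq hg h]
  exact div_mem (hmem f) (hmem g)

theorem trdeg_functionField :
    Algebra.trdeg k (FunctionField p) = Algebra.trdeg k (MvPolynomial ι k ⧸ p) := by
  have : Algebra.IsAlgebraic (MvPolynomial ι k ⧸ p) (FunctionField p) :=
    IsLocalization.isAlgebraic _ (nonZeroDivisors (MvPolynomial ι k ⧸ p))
  have : @FaithfulSMul k (MvPolynomial ι k ⧸ p) Algebra.toSMul :=
    (faithfulSMul_iff_algebraMap_injective k (MvPolynomial ι k ⧸ p)).2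
      (algebraMap k (MvPolynomial ι k ⧸ p)).injective
  rw [← trdeg_add_eq k (MvPolynomial ι k ⧸ p) (A := FunctionField p), trdeg_eq_zero (R := MvPolynomial ι k ⧸ p), add_zero]

variable [Fintype ι]

/-- The dimension of the variety of an ideal. -/
noncomputable def idealDim (p : Ideal (MvPolynomial ι k)) : ℕ :=
  (Algebra.trdeg k (MvPolynomial ι k ⧸ p)).toNat

theorem finrank_span_gradSet_genericPoint [CharZero k] :
    Module.finrank (FunctionField p) (Submodule.span (FunctionField p) (gradSet p (genericPoint p))) +
      idealDim p = Fintype.card ι := by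
  have h := finrank_span_gradSet_generic p (genericPoint p)
    (fun f => aeval_genericPoint_eq_zero p) (adjoin_genericPoint p)
    (by rw [trdeg_functionField]; exact trdeg_lt_aleph0_of_finiteType)
  rwa [trdeg_functionField] at h

theorem exists_finite_basis_gradSet {K : Type u} [Field K] [Algebra k K]
    (p : Ideal (MvPolynomial ι k)) (x : ι → K) :
    ∃ (m : ℕ) (f : Fin m → MvPolynomial ι k), (∀ j, f j ∈ p) ∧
      LinearIndependent K (fun j i => aeval x (grad (f j) i)) ∧
      Submodule.span K (Set.range fun j i => aeval x (grad (f j) i)) =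
        Submodule.span K (gradSet p x) := by
  obtain ⟨b, hb, hspan, hli⟩ := exists_linearIndependent K (gradSet p x)
  have hfin : Finite b := hli.finite
  obtain ⟨m, ⟨e⟩⟩ := Finite.exists_equiv_fin b
  choose f hf hfe using fun j => hb (e.symm j).2
  have h1 : (fun j i => aeval x (grad (f j) i)) = fun j => (e.symm j : ι → K) :=
    _root_.funext fun j => (hfe j).symm
  refine ⟨m, f, hf, ?_, ?_⟩
  · rw [h1]; exact hli.comp _ e.symm.injective
  · rw [h1, ← hspan]
    congr 1
    ext v
    constructor
    · rintro ⟨j, rfl⟩; exact (e.symm j).2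
    · intro hv; exact ⟨e ⟨v, hv⟩, by simp⟩

/-- The rank of the gradients at a point is at most the codimension. -/
theorem finrank_span_gradSet_add_idealDim_le [CharZero k] (x : ι → k)
    (hx : ∀ f ∈ p, aeval x f = 0) :
    Module.finrank k (Submodule.span k (gradSet p x)) + idealDim p ≤ Fintype.card ι := by
  classical
  obtain ⟨m, f, hf, hli, hspan⟩ := exists_finite_basis_gradSet p x
  obtain ⟨M, hM⟩ := exists_det_ne_zero_of_linearIndependent (Matrix.of fun j => grad (f j)) x
    (fun a => ⟨C a, 1, by simp, by simp⟩) hli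
  -- Rank can only grow from `x` to the generic point: a determinant nonzero at a point of the
  -- variety is not in `p`.
  have hD : aeval (genericPoint p) (Matrix.of (fun j => grad (f j)) * M).det ≠ 0 := fun h0 =>
    hM (hx _ ((aeval_genericPoint_eq_zero p).1 h0))
  have hli' : LinearIndependent (FunctionField p)
      fun j i => aeval (genericPoint p) (grad (f j) i) :=
    linearIndependent_of_det_ne_zero _ M (genericPoint p) hD
  rw [← hspan, finrank_span_eq_card hli, ← finrank_span_gradSet_genericPoint p,
    ← finrank_span_eq_card hli']
  refine Nat.add_le_add_right (Submodule.finrank_mono (Submodule.span_mono ?_)) _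
  rintro _ ⟨j, rfl⟩
  exact ⟨f j, hf j, rfl⟩

/-- At a general point the rank of the gradients is the codimension. -/
theorem exists_notMem_forall_le_finrank [CharZero k] :
    ∃ h ∉ p, ∀ x : ι → k, aeval x h ≠ 0 →
      Fintype.card ι ≤ Module.finrank k (Submodule.span k (gradSet p x)) + idealDim p := by
  obtain ⟨m, f, hf, hli, hspan⟩ := exists_finite_basis_gradSet p (genericPoint p)
  obtain ⟨M, hM⟩ := exists_det_ne_zero_of_linearIndependent (Matrix.of fun j => grad (f j)) (genericPoint p)
    (exists_mul_aeval_genericPoint p) hli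
  refine ⟨_, fun h => hM ((aeval_genericPoint_eq_zero p).2 h), fun x hx => ?_⟩
  have hli' : LinearIndependent k fun j i => aeval x (grad (f j) i) :=
    linearIndependent_of_det_ne_zero _ M x hx
  rw [← finrank_span_gradSet_genericPoint p, ← hspan, finrank_span_eq_card hli,
    ← finrank_span_eq_card hli']
  refine Nat.add_le_add_right (Submodule.finrank_mono (Submodule.span_mono ?_)) _
  rintro _ ⟨j, rfl⟩
  exact ⟨f j, hf j, rfl⟩

/-- Over a regular point the fibre of the conormal variety is the normal space. -/
theorem mem_span_gradSet_of_conormalIdeal [CharZero k] (x y : ι → k)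
    (hx : Module.finrank k (Submodule.span k (gradSet p x)) + idealDim p = Fintype.card ι)
    (hxy : ∀ F ∈ conormalIdeal p, aeval (Sum.elim x y) F = 0) :
    y ∈ Submodule.span k (gradSet p x) := by
  by_contra hy
  obtain ⟨m, f, hf, hli, hspan⟩ := exists_finite_basis_gradSet p x
  -- The rows are the normal coordinates `y` and the gradients of the `f j`; they are independent at
  -- `(x, y)` when `y` is outside the span.
  let w : Matrix (Option (Fin m)) ι (MvPolynomial (ι ⊕ ι) k) :=
    Matrix.of fun o => o.elim (fun i => X (Sum.inr i)) fun j i => rename Sum.inl (grad (f j) i)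
  have hw : ∀ {L : Type u} [Field L] [Algebra k L] (a b : ι → L),
      (fun o i => aeval (Sum.elim a b) (w o i)) =
        fun o => o.elim b fun j i => aeval a (grad (f j) i) := fun a b => by
    ext o i
    cases o <;> simp [w, aeval_rename]
  have hli1 : LinearIndependent k fun o i => aeval (Sum.elim x y) (w o i) := by
    rw [hw]
    refine linearIndependent_option.2 ⟨hli, ?_⟩
    change y ∉ Submodule.span k (Set.range fun j i => aeval x (grad (f j) i))
    rwa [hspan]
  obtain ⟨M, hM⟩ := exists_det_ne_zero_of_linearIndependent w (Sum.elim x y)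
    (fun a => ⟨C a, 1, by simp, by simp⟩) hli1
  -- The determinant lies in `conormalIdeal p`: over the generic point all `m + 1` rows lie in the
  -- span of the gradients, which has dimension `m` because `x` is regular.
  refine hM (hxy _ fun v hv => ?_)
  rw [← aeval_genericPoint_eq_zero p, aeval_aeval_sumElim]
  by_contra h0
  have hli2 := linearIndependent_of_det_ne_zero w M _ h0
  have h1 : Submodule.span (FunctionField p) (Set.range fun o i => aeval (Sum.elim (genericPoint p)
      fun i => aeval (genericPoint p) (v i)) (w o i)) ≤
      Submodule.span _ (gradSet p (genericPoint p)) := by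
    rw [hw, Submodule.span_le]
    rintro _ ⟨o, rfl⟩
    cases o with
    | none => exact aeval_mem_span_of_mem_gradModule _ hv
    | some j => exact Submodule.subset_span ⟨f j, hf j, rfl⟩
  have h2 := Submodule.finrank_mono h1
  rw [finrank_span_eq_card hli2, Fintype.card_option, ← finrank_span_eq_card hli, hspan] at h2
  have h3 := finrank_span_gradSet_genericPoint p
  omega

end GenericPoint

/-! ### The generic point of the conormal variety -/

section GenericConormalPoint

universe u
variable {k ι : Type u} [Field k]

/-- Independence over `K` gives a left inverse with entries in `K ⊆ M` that recovers the
coefficients. It serves to show that the indeterminates of the generic normal vector are generated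
by `x` and `y`. -/
theorem mem_of_linear_combination_mem {K L κ : Type*} [Field K] [Field L] [Algebra K L]
    [Algebra k L] [Fintype κ] [DecidableEq κ] {ι : Type*} [Fintype ι] (M : IntermediateField k L)
    (hK : ∀ a : K, algebraMap K L a ∈ M) (g : κ → ι → K) (hg : LinearIndependent K g) (c : κ → L)
    (hc : ∀ i, ∑ j, c j * algebraMap K L (g j i) ∈ M) (j : κ) : c j ∈ M := by
  classical
  obtain ⟨φ, hφ⟩ := LinearMap.exists_leftInverse_of_injective
    (Fintype.linearCombination K g) (LinearMap.ker_eq_bot.2 hg.fintypeLinearCombination_injective)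
  let e : ι → ι → K := fun i i' => if i = i' then 1 else 0
  have hφg : ∀ j', ∑ i, g j' i * φ (e i) j = if j = j' then 1 else 0 := fun j' => by
    have h1 := congr_fun (LinearMap.congr_fun hφ (Pi.single j' 1)) j
    rw [LinearMap.comp_apply, Fintype.linearCombination_apply_single, one_smul,
      LinearMap.id_apply, LinearMap.pi_apply_eq_sum_univ φ, Finset.sum_apply,
      Pi.single_apply] at h1
    exact h1
  have h2 : c j = ∑ i, (∑ j, c j * algebraMap K L (g j i)) * algebraMap K L (φ (e i) j) := by
    simp only [Finset.sum_mul]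
    rw [Finset.sum_comm]
    simp only [mul_assoc, ← Finset.mul_sum, ← map_mul, ← map_sum, hφg]
    simp
  rw [h2]
  exact sum_mem fun i _ => mul_mem (hc i) (hK _)

theorem eq_top_of_isFractionRing {K L κ : Type*} [Field K] [Field L] [Algebra K L]
    [Algebra k L] [Algebra (MvPolynomial κ K) L] [IsFractionRing (MvPolynomial κ K) L]
    (M : IntermediateField k L) (hK : ∀ a : K, algebraMap (MvPolynomial κ K) L (C a) ∈ M)
    (hX : ∀ j, algebraMap (MvPolynomial κ K) L (X j) ∈ M) : M = ⊤ := by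
  have hRM : ∀ F, algebraMap (MvPolynomial κ K) L F ∈ M := fun F => by
    induction F using MvPolynomial.induction_on with
    | C a => exact hK a
    | add a b ha hb => rw [map_add]; exact add_mem ha hb
    | mul_X a j ha => rw [map_mul]; exact mul_mem ha (hX j)
  rw [eq_top_iff]
  intro a _
  obtain ⟨r, s, _, rfl⟩ := IsFractionRing.div_surjective (A := MvPolynomial κ K) a
  exact div_mem (hRM r) (hRM s)

/-- The conormal variety of an irreducible variety has a generic point, and the dimension of the
ambient space. -/
theorem exists_generic_conormal_point [CharZero k] [Fintype ι]
    (p : Ideal (MvPolynomial ι k)) [p.IsPrime] :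
    ∃ (L : Type u) (_ : Field L) (_ : Algebra k L) (x y : ι → L),
      (∀ f, aeval x f = 0 ↔ f ∈ p) ∧ y ∈ Submodule.span L (gradSet p x) ∧
      (∀ F, aeval (Sum.elim x y) F = 0 ↔ F ∈ conormalIdeal p) ∧
      (Algebra.trdeg k L).toNat = Fintype.card ι ∧ Algebra.trdeg k L < Cardinal.aleph0 ∧
      IntermediateField.adjoin k (Set.range (Sum.elim x y)) = ⊤ := by
  classical
  let K := FunctionField p
  obtain ⟨m, f, hf, hli, hspan⟩ := exists_finite_basis_gradSet p (genericPoint p)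
  obtain ⟨g, hg⟩ : ∃ g : Fin m → ι → K, g = fun j i => aeval (genericPoint p) (grad (f j) i) :=
    ⟨_, rfl⟩
  rw [← hg] at hli hspan
  let R := MvPolynomial (Fin m) K
  let L := FractionRing R
  have hRL := IsFractionRing.injective R L
  let x : ι → L := fun i => algebraMap K L (genericPoint p i)
  let y' : ι → R := fun i => ∑ j, X j * C (g j i)
  let y : ι → L := fun i => algebraMap R L (y' i)
  have hxf : ∀ f : MvPolynomial ι k, aeval x f = algebraMap K L (aeval (genericPoint p) f) :=
    fun f => by rw [← aeval_algebraMap_apply]; rfl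
  have hx : ∀ f : MvPolynomial ι k, aeval x f = 0 ↔ f ∈ p := fun f => by
    rw [hxf, FaithfulSMul.algebraMap_eq_zero_iff, aeval_genericPoint_eq_zero]
  have hCL : ∀ a : K, algebraMap R L (C a) = algebraMap K L a := fun a =>
    (IsScalarTower.algebraMap_apply K R L a).symm
  have hyi : ∀ i, y i = ∑ j, algebraMap R L (X j) * algebraMap K L (g j i) := fun i => by
    simp [y, y', hCL]
  have hyg : y = ∑ j, algebraMap R L (X j) • fun i => algebraMap K L (g j i) := by
    ext i
    rw [hyi, Finset.sum_apply]
    rfl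
  have hy : y ∈ Submodule.span L (gradSet p x) := by
    rw [hyg]
    refine Submodule.sum_mem _ fun j _ => Submodule.smul_mem _ _ (Submodule.subset_span ?_)
    exact ⟨f j, hf j, by ext i; rw [hxf, hg]⟩
  refine ⟨L, inferInstance, inferInstance, x, y, hx, hy, ?_, ?_⟩
  · intro F
    constructor
    -- At the generic point of `p`, `w` is a combination of the basis `g` with coefficients `c`;
    -- specializing the indeterminates to `c` preserves the vanishing of `F`.
    · intro hF w hw
      rw [← aeval_genericPoint_eq_zero p, aeval_aeval_sumElim]
      have h1 := aeval_mem_span_of_mem_gradModule (genericPoint p) hw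
      rw [← hspan] at h1
      obtain ⟨c, hc⟩ := (Submodule.mem_span_range_iff_exists_fun K).1 h1
      have h2 : aeval (Sum.elim (fun i => C (genericPoint p i)) y') F = 0 := by
        apply hRL
        rw [map_zero, ← aeval_algebraMap_apply, ← hF]
        congr 2
        ext i
        cases i
        · simp [x, hCL]
        · rfl
      have h3 := congr_arg (eval c) h2
      rw [map_zero] at h3
      rw [← h3, ← coe_aeval_eq_eval]
      have h4 : ((aeval c : R →ₐ[K] K).restrictScalars k).comp
          (aeval (Sum.elim (fun i => C (genericPoint p i)) y')) =
          (aeval (Sum.elim (genericPoint p) fun i => aeval (genericPoint p) (w i)) :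
            MvPolynomial (ι ⊕ ι) k →ₐ[k] K) := by
        ext i
        cases i with
        | inl i => simp
        | inr i =>
          have := congr_fun hc i
          simp only [Finset.sum_apply, Pi.smul_apply, smul_eq_mul] at this
          simp [y', this]
      exact (DFunLike.congr_fun h4 F).symm
    · intro hF
      refine aeval_eq_zero_on_span F x _ (fun z hz => ?_) hy
      obtain ⟨w, hw, rfl⟩ := exists_mem_gradModule_of_mem_span x hz
      rw [← aeval_aeval_sumElim, hx]
      exact hF w hw
  -- The `m` indeterminates contribute the codimension and `K` the dimension of the variety.
  · have hcard := finrank_span_gradSet_genericPoint p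
    rw [← hspan, finrank_span_eq_card hli, Fintype.card_fin] at hcard
    have ht1 : Algebra.trdeg K L = m := by
      have : Algebra.IsAlgebraic R L := IsLocalization.isAlgebraic _ (nonZeroDivisors R)
      rw [← trdeg_add_eq K R (A := L), trdeg_eq_zero (R := R), add_zero, MvPolynomial.trdeg_of_isDomain]
      simp
    have ht2 : Algebra.trdeg k K < Cardinal.aleph0 := by
      rw [trdeg_functionField]; exact trdeg_lt_aleph0_of_finiteType
    have ht3 : Algebra.trdeg k K = (idealDim p : ℕ) := by
      rw [idealDim, ← trdeg_functionField, Cardinal.cast_toNat_of_lt_aleph0 ht2]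
    have ht : Algebra.trdeg k L = (Fintype.card ι : ℕ) := by
      rw [← trdeg_add_eq k K (A := L), ht1, ht3, ← hcard]
      push_cast
      ring
    refine ⟨by rw [ht, Cardinal.toNat_natCast], by rw [ht]; exact Cardinal.natCast_lt_aleph0, ?_⟩
    set M := IntermediateField.adjoin k (Set.range (Sum.elim x y)) with hM
    have hxM : ∀ i, x i ∈ M := fun i => IntermediateField.subset_adjoin _ _ ⟨Sum.inl i, rfl⟩
    have hyM : ∀ i, y i ∈ M := fun i => IntermediateField.subset_adjoin _ _ ⟨Sum.inr i, rfl⟩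
    have hKM : ∀ a : K, algebraMap K L a ∈ M := fun a => by
      have ha : a ∈ IntermediateField.adjoin k (Set.range (genericPoint p)) :=
        adjoin_genericPoint p ▸ trivial
      have h1 : IntermediateField.adjoin k (Set.range (genericPoint p)) ≤
          M.comap (IsScalarTower.toAlgHom k K L) := by
        rw [IntermediateField.adjoin_le_iff]
        rintro _ ⟨i, rfl⟩
        exact hxM i
      exact h1 ha
    refine eq_top_of_isFractionRing (K := K) M (fun a => by rw [hCL]; exact hKM a) ?_
    exact mem_of_linear_combination_mem M hKM g hli _ fun i => by rw [← hyi]; exact hyM i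

end GenericConormalPoint

/-! ### Biduality for irreducible cones, in terms of ideals -/

section Biduality

universe u
variable {k ι : Type u} [Field k]

/-- The quotient by `p` is the ring `k[z]`, over which the field `L = k(z)` is algebraic. -/
theorem idealDim_eq_of_generic_point [Fintype ι] {L : Type u} [Field L] [Algebra k L]
    (p : Ideal (MvPolynomial ι k))
    (z : ι → L) (hz : ∀ f, aeval z f = 0 ↔ f ∈ p)
    (hL : IntermediateField.adjoin k (Set.range z) = ⊤) :
    idealDim p = (Algebra.trdeg k L).toNat := by
  have hp : p = RingHom.ker (aeval z : MvPolynomial ι k →ₐ[k] L) := by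
    ext f; rw [RingHom.mem_ker, hz]
  subst hp
  let A := Algebra.adjoin k (Set.range z)
  have hA : Algebra.IsAlgebraic A L := by
    have h1 : Algebra.IsAlgebraic (IntermediateField.adjoin k (Set.range z)) L := by
      rw [hL, Algebra.isAlgebraic_iff_isIntegral]
      exact Algebra.isIntegral_of_surjective IntermediateField.topEquiv.surjective
    exact (IntermediateField.isAlgebraic_adjoin_iff_top).1 h1
  have h2 : Algebra.trdeg k A = Algebra.trdeg k L := by
    rw [← trdeg_add_eq k A (A := L), trdeg_eq_zero (R := A), add_zero]
  have e : (MvPolynomial ι k ⧸ RingHom.ker (aeval z : MvPolynomial ι k →ₐ[k] L)) ≃ₐ[k] A :=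
    (Ideal.quotientKerEquivRange (aeval z : MvPolynomial ι k →ₐ[k] L)).trans
      (Subalgebra.equivOfEq _ _ (Algebra.adjoin_range_eq_range_aeval k z).symm)
  rw [idealDim, ← h2, e.trdeg_eq]

theorem eq_of_le_of_idealDim_le [Fintype ι] {p q : Ideal (MvPolynomial ι k)} [p.IsPrime]
    [q.IsPrime] (hpq : p ≤ q) (h : idealDim p ≤ idealDim q) : p = q := by
  refine le_antisymm hpq fun f hf => ?_
  have hinj := injective_of_surjective_of_trdeg_le (Ideal.Quotient.factorₐ k hpq)
    (Ideal.Quotient.factor_surjective hpq) trdeg_lt_aleph0_of_finiteType h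
  rw [← Ideal.Quotient.eq_zero_iff_mem]
  apply hinj
  rw [map_zero]
  exact Ideal.Quotient.eq_zero_iff_mem.2 hf

/-- The ideal of the dual variety. -/
noncomputable def dualIdeal (p : Ideal (MvPolynomial ι k)) : Ideal (MvPolynomial ι k) :=
  (conormalIdeal p).comap (rename Sum.inr : MvPolynomial ι k →ₐ[k] MvPolynomial (ι ⊕ ι) k)

theorem aeval_sumElim_rename_inr {L : Type*} [Field L] [Algebra k L] (x y : ι → L)
    (f : MvPolynomial ι k) : aeval (Sum.elim x y) (rename Sum.inr f) = aeval y f := by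
  rw [aeval_rename, Sum.elim_comp_inr]

theorem aeval_sumElim_rename_swap {L : Type*} [Field L] [Algebra k L] (x y : ι → L)
    (F : MvPolynomial (ι ⊕ ι) k) :
    aeval (Sum.elim x y) (rename Sum.swap F) = aeval (Sum.elim y x) F := by
  rw [aeval_rename]
  congr 2
  ext i
  cases i <;> rfl

variable [CharZero k] [Fintype ι]

theorem dualIdeal_isPrime (p : Ideal (MvPolynomial ι k)) [p.IsPrime] : (dualIdeal p).IsPrime := by
  obtain ⟨L, _, _, x, y, -, -, hq, -⟩ := exists_generic_conormal_point p
  have : dualIdeal p = RingHom.ker (aeval y : MvPolynomial ι k →ₐ[k] L) := by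
    ext f
    rw [RingHom.mem_ker, ← aeval_sumElim_rename_inr x y, hq]
    rfl
  rw [this]
  exact RingHom.ker_isPrime _

omit [CharZero k] in
theorem dotProduct_eq_zero_of_mem_span {S : Set (ι → k)} (v : ι → k)
    (h : ∀ w ∈ S, v ⬝ᵥ w = 0) {w : ι → k} (hw : w ∈ Submodule.span k S) : v ⬝ᵥ w = 0 := by
  induction hw using Submodule.span_induction with
  | mem w hw => exact h w hw
  | zero => simp
  | add a b _ _ ha hb => rw [dotProduct_add, ha, hb, add_zero]
  | smul c a _ ha => rw [dotProduct_smul, ha, smul_zero]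

/-- At the generic point of the conormal variety of a cone, the first component is normal to the
dual variety. -/
theorem mem_span_gradSet_dualIdeal {L : Type u} [Field L] [Algebra k L]
    (p : Ideal (MvPolynomial ι k)) (hcone : ∀ f ∈ p, ∑ i, X i * grad f i ∈ p) (x y : ι → L)
    (hx : ∀ f ∈ p, aeval x f = 0) (hy : y ∈ Submodule.span L (gradSet p x))
    (hq : ∀ f, aeval y f = 0 → f ∈ dualIdeal p) :
    x ∈ Submodule.span L (gradSet (dualIdeal p) y) := by
  classical
  have : CharZero L := (algebraMap k L).charZero_iff (algebraMap k L).injective |>.1 inferInstance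
  by_contra hxs
  obtain ⟨φ, hφx, hφ⟩ := Submodule.exists_le_ker_of_notMem hxs
  let v : ι → L := fun i => φ fun j => if i = j then 1 else 0
  have hφv : ∀ w, φ w = v ⬝ᵥ w := fun w => by
    rw [LinearMap.pi_apply_eq_sum_univ φ, dotProduct]
    exact Finset.sum_congr rfl fun i _ => mul_comm _ _
  -- `v` is tangent to the dual variety at `y` but `v · x ≠ 0`; `D` realizes it as `D y = v`.
  obtain ⟨D, hD⟩ := exists_derivation_of_orthogonal (dualIdeal p) y hq v fun w hw => by
    rw [← hφv]; exact hφ (Submodule.subset_span hw)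
  -- `D x` is tangent to the variety of `p` and `y` is normal to it.
  have h1 : (fun i => D (x i)) ⬝ᵥ y = 0 := by
    refine dotProduct_eq_zero_of_mem_span _ (fun w hw => ?_) hy
    obtain ⟨f, hf, rfl⟩ := hw
    rw [dotProduct, ← derivation_aeval, hx f hf, map_zero]
  -- Euler's relation: on a cone the position vector is itself tangent.
  have h2 : x ⬝ᵥ y = 0 := by
    refine dotProduct_eq_zero_of_mem_span _ (fun w hw => ?_) hy
    obtain ⟨f, hf, rfl⟩ := hw
    rw [← hx _ (hcone f hf)]
    simp [dotProduct]
  simp only [dotProduct] at h1 h2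
  have h3 := congr_arg D h2
  simp only [map_sum, Derivation.leibniz, smul_eq_mul, map_zero, Finset.sum_add_distrib] at h3
  apply hφx
  rw [hφv, dotProduct, ← h3]
  simp only [mul_comm (y _), h1, add_zero]
  exact Finset.sum_congr rfl fun i _ => by rw [hD, mul_comm]

/-- Biduality for irreducible cones. -/
theorem conormalIdeal_dualIdeal (p : Ideal (MvPolynomial ι k)) [p.IsPrime]
    (hcone : ∀ f ∈ p, ∑ i, X i * grad f i ∈ p) :
    conormalIdeal (dualIdeal p) = (conormalIdeal p).comap
      (rename Sum.swap : MvPolynomial (ι ⊕ ι) k →ₐ[k] MvPolynomial (ι ⊕ ι) k) := by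
  have := dualIdeal_isPrime p
  obtain ⟨L, _, _, x, y, hx, hy, hq, hd, -, htop⟩ := exists_generic_conormal_point p
  obtain ⟨L', _, _, x', y', -, -, hq', hd', -, htop'⟩ := exists_generic_conormal_point (dualIdeal p)
  have hdual : ∀ f, aeval y f = 0 ↔ f ∈ dualIdeal p := fun f => by
    rw [← aeval_sumElim_rename_inr x y, hq]; rfl
  have hswap : ∀ F, aeval (Sum.elim y x) F = 0 ↔ F ∈ (conormalIdeal p).comap
      (rename Sum.swap : MvPolynomial (ι ⊕ ι) k →ₐ[k] MvPolynomial (ι ⊕ ι) k) := fun F => by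
    rw [← aeval_sumElim_rename_swap, hq]; rfl
  have hprime : ∀ {M : Type u} [Field M] [Algebra k M] (z : ι ⊕ ι → M)
      (q : Ideal (MvPolynomial (ι ⊕ ι) k)), (∀ F, aeval z F = 0 ↔ F ∈ q) → q.IsPrime := by
    intro M _ _ z q h
    have : q = RingHom.ker (aeval z : MvPolynomial (ι ⊕ ι) k →ₐ[k] M) := by
      ext f; rw [RingHom.mem_ker, h]
    rw [this]
    exact RingHom.ker_isPrime _
  have := hprime _ _ hswap
  have := hprime _ _ hq'
  -- Both ideals are prime of dimension `Fintype.card ι`, so one inclusion is enough.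
  refine eq_of_le_of_idealDim_le (fun F hF => ?_) (le_of_eq ?_)
  · rw [← hswap]
    refine aeval_eq_zero_on_span F y _ (fun z hz => ?_)
      (mem_span_gradSet_dualIdeal p hcone x y (fun f => (hx f).2) hy fun f => (hdual f).1)
    obtain ⟨w, hw, rfl⟩ := exists_mem_gradModule_of_mem_span y hz
    rw [← aeval_aeval_sumElim, hdual]
    exact hF w hw
  · rw [idealDim_eq_of_generic_point _ _ hq' htop', idealDim_eq_of_generic_point _ _ hswap, hd, hd']
    rw [← htop]
    congr 1
    ext a
    simp [or_comm]

end Biduality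

/-! ### Polynomial functions and regular points in coordinates -/

section Coordinates

variable {V ι : Type} [AddCommGroup V] [Module ℂ V] (e : V ≃ₗ[ℂ] (ι → ℂ))

/-- The ideal of the polynomials that vanish on a set, in given coordinates. -/
noncomputable def coordIdeal (Z : Set V) : Ideal (MvPolynomial ι ℂ) where
  carrier := {f | ∀ v ∈ Z, aeval (e v) f = 0}
  add_mem' := fun hf hg v hv => by rw [map_add, hf v hv, hg v hv, add_zero]
  zero_mem' := fun v _ => map_zero _
  smul_mem' := fun c f hf v hv => by rw [smul_eq_mul, map_mul, hf v hv, mul_zero]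

theorem mem_coordIdeal {Z : Set V} {f : MvPolynomial ι ℂ} :
    f ∈ coordIdeal e Z ↔ ∀ v ∈ Z, aeval (e v) f = 0 := Iff.rfl

variable [Fintype ι]

theorem mem_polyFun_iff {g : V → ℂ} :
    g ∈ polyFun V ↔ ∃ f : MvPolynomial ι ℂ, g = fun v => aeval (e v) f := by
  classical
  constructor
  · intro hg
    induction hg using Algebra.adjoin_induction with
    | mem g hg =>
      obtain ⟨φ, rfl⟩ := hg
      refine ⟨∑ i, C (φ (e.symm fun j => if i = j then 1 else 0)) * X i, ?_⟩
      ext v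
      have := LinearMap.pi_apply_eq_sum_univ (φ ∘ₗ e.symm.toLinearMap) (e v)
      simp only [LinearMap.comp_apply, LinearEquiv.coe_coe, LinearEquiv.symm_apply_apply,
        smul_eq_mul] at this
      rw [this]
      simp [mul_comm]
    | algebraMap r => exact ⟨C r, by ext v; simp⟩
    | add f g _ _ hf hg =>
      obtain ⟨a, rfl⟩ := hf
      obtain ⟨b, rfl⟩ := hg
      exact ⟨a + b, by ext v; simp⟩
    | mul f g _ _ hf hg =>
      obtain ⟨a, rfl⟩ := hf
      obtain ⟨b, rfl⟩ := hg
      exact ⟨a * b, by ext v; simp⟩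
  · rintro ⟨f, rfl⟩
    induction f using MvPolynomial.induction_on with
    | C a => simp only [aeval_C]; exact (polyFun V).algebraMap_mem a
    | add a b ha hb => simp only [map_add]; exact (polyFun V).add_mem ha hb
    | mul_X a i ha =>
      simp only [map_mul, aeval_X]
      refine (polyFun V).mul_mem ha (Algebra.subset_adjoin ⟨LinearMap.proj i ∘ₗ e.toLinearMap, ?_⟩)
      rfl

/-- Polynomials in the coordinates are the polynomial functions. -/
noncomputable def polyFunEquiv : MvPolynomial ι ℂ ≃ₐ[ℂ] polyFun V :=
  AlgEquiv.ofBijective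
    ((AlgHom.pi fun v : V => (aeval (e v) : MvPolynomial ι ℂ →ₐ[ℂ] ℂ)).codRestrict (polyFun V)
      fun f => (mem_polyFun_iff e).2 ⟨f, rfl⟩) <| by
    constructor
    · intro f g h
      refine MvPolynomial.funext fun x => ?_
      have := congr_fun (congr_arg Subtype.val h) (e.symm x)
      simpa [coe_aeval_eq_eval] using this
    · rintro ⟨g, hg⟩
      obtain ⟨f, rfl⟩ := (mem_polyFun_iff e).1 hg
      exact ⟨f, rfl⟩

theorem coordIdeal_eq_comap (Z : Set V) :
    coordIdeal e Z = (vanishing Z).comap (polyFunEquiv e) := rfl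

theorem coordIdeal_isPrime {Z : Set V} (h : (vanishing Z).IsPrime) : (coordIdeal e Z).IsPrime := by
  rw [coordIdeal_eq_comap]
  exact Ideal.comap_isPrime _ _

theorem mem_zariskiClosure_iff {Z : Set V} {v : V} :
    v ∈ zariskiClosure Z ↔ ∀ f ∈ coordIdeal e Z, aeval (e v) f = 0 := by
  constructor
  · intro h f hf
    exact h (polyFunEquiv e f) hf
  · intro h g hg
    obtain ⟨f, rfl⟩ := (polyFunEquiv e).surjective g
    exact h f hg

omit [Fintype ι] in
theorem vanishing_zariskiClosure (Z : Set V) : vanishing (zariskiClosure Z) = vanishing Z := by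
  ext f
  exact ⟨fun h v hv => h v fun g hg => hg v hv, fun h v hv => hv f h⟩

theorem coordIdeal_zariskiClosure (Z : Set V) :
    coordIdeal e (zariskiClosure Z) = coordIdeal e Z := by
  rw [coordIdeal_eq_comap, vanishing_zariskiClosure, coordIdeal_eq_comap]

theorem dimVariety_eq (Z : Set V) :
    dimVariety Z = Algebra.trdeg ℂ (MvPolynomial ι ℂ ⧸ coordIdeal e Z) := by
  have e' : (MvPolynomial ι ℂ ⧸ coordIdeal e Z) ≃ₐ[ℂ] (polyFun V ⧸ vanishing Z) :=
    Ideal.quotientEquivAlg _ _ (polyFunEquiv e) (by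
      rw [coordIdeal_eq_comap]
      exact (Ideal.map_comap_of_surjective (polyFunEquiv e : MvPolynomial ι ℂ →+* polyFun V)
        (polyFunEquiv e).surjective _).symm)
  exact e'.trdeg_eq.symm

theorem hasLineDerivAt_aeval (f : MvPolynomial ι ℂ) (x v : V) :
    HasLineDerivAt ℂ (fun u => aeval (e u) f) ((fun i => aeval (e x) (grad f i)) ⬝ᵥ e v) x v := by
  classical
  simp only [grad, dotProduct]
  induction f using MvPolynomial.induction_on with
  | C a =>
    simp only [aeval_C, pderiv_C, map_zero, zero_mul, Finset.sum_const_zero]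
    exact hasDerivAt_const (0 : ℂ) _
  | add a b ha hb =>
    simp only [map_add, add_mul, Finset.sum_add_distrib]
    exact HasDerivAt.add ha hb
  | mul_X a i ha =>
    have h : HasLineDerivAt ℂ (fun u => e u i) (e v i) x v := by
      have h : HasDerivAt (fun t : ℂ => e x i + t * e v i) (e v i) 0 := by
        simpa using ((hasDerivAt_id (0 : ℂ)).mul_const (e v i)).const_add (e x i)
      simpa [HasLineDerivAt] using h
    have h2 := HasDerivAt.mul ha h
    simp only [zero_smul, add_zero] at h2
    have h3 : ∑ j, aeval (e x) (pderiv j (a * X i)) * e v j =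
        (∑ j, aeval (e x) (pderiv j a) * e v j) * e x i + aeval (e x) a * e v i := by
      simp only [Derivation.leibniz, pderiv_X, smul_eq_mul, map_add, map_mul, aeval_X, add_mul,
        Finset.sum_add_distrib, Pi.single_apply, Finset.sum_mul]
      rw [add_comm]
      congr 1
      · exact Finset.sum_congr rfl fun i _ => by ring
      · simp
    rw [h3]
    simp only [map_mul, aeval_X]
    exact h2

theorem mem_tangentSpace_iff {Z : Set V} {x v : V} :
    v ∈ tangentSpace Z x ↔ ∀ w ∈ gradSet (coordIdeal e Z) (e x), w ⬝ᵥ e v = 0 := by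
  constructor
  · rintro h _ ⟨f, hf, rfl⟩
    rw [← (hasLineDerivAt_aeval e f x v).lineDeriv]
    exact h (polyFunEquiv e f) hf
  · intro h g hg
    obtain ⟨f, rfl⟩ := (polyFunEquiv e).surjective g
    have : ((polyFunEquiv e f : polyFun V) : V → ℂ) = fun u => aeval (e u) f := rfl
    rw [this, (hasLineDerivAt_aeval e f x v).lineDeriv]
    exact h _ ⟨f, hg, rfl⟩

/-- The sum is the derivative of `f` along the line through the origin and `v`, which lies in the
cone, so `f` is zero on it. -/
theorem sum_X_mul_grad_mem_coordIdeal {Z : Set V} (hZ : ∀ (c : ℂ), ∀ z ∈ Z, c • z ∈ Z) :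
    ∀ f ∈ coordIdeal e Z, ∑ i, X i * grad f i ∈ coordIdeal e Z := by
  intro f hf v hv
  have h1 := (hasLineDerivAt_aeval e f v v).lineDeriv
  have h2 : lineDeriv ℂ (fun u => aeval (e u) f) v v = 0 := by
    have : (fun t : ℂ => aeval (e (v + t • v)) f) = fun _ => 0 := by
      ext t
      have h3 : v + t • v = (1 + t) • v := by rw [add_smul, one_smul]
      rw [h3]
      exact hf _ (hZ _ v hv)
    rw [lineDeriv, this, deriv_const]
  rw [h2] at h1
  rw [h1]
  simp [dotProduct, mul_comm]

/-- The standard bilinear form, for which the orthogonal complement is taken in coordinates. -/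
noncomputable def dotForm (ι : Type) [Fintype ι] [DecidableEq ι] :
    LinearMap.BilinForm ℂ (ι → ℂ) := Matrix.toBilin' 1

theorem dotForm_apply [DecidableEq ι] (v w : ι → ℂ) : dotForm ι v w = v ⬝ᵥ w := by
  simp [dotForm, Matrix.toBilin'_apply']

theorem dotForm_nondegenerate [DecidableEq ι] : (dotForm ι).Nondegenerate :=
  LinearMap.BilinForm.nondegenerate_toBilin'_of_det_ne_zero' 1 (by simp)

theorem map_tangentSpace [DecidableEq ι] (Z : Set V) (x : V) :
    (tangentSpace Z x).map (e : V →ₗ[ℂ] (ι → ℂ)) =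
      (dotForm ι).orthogonal (Submodule.span ℂ (gradSet (coordIdeal e Z) (e x))) := by
  ext u
  obtain ⟨v, rfl⟩ := e.surjective u
  have h1 : e v ∈ (tangentSpace Z x).map (e : V →ₗ[ℂ] (ι → ℂ)) ↔ v ∈ tangentSpace Z x :=
    ⟨fun ⟨w, hw, h⟩ => e.injective h ▸ hw, fun h => ⟨v, h, rfl⟩⟩
  rw [h1, mem_tangentSpace_iff e, LinearMap.BilinForm.mem_orthogonal_iff]
  constructor
  · intro h w hw
    change dotForm ι w (e v) = 0
    rw [dotForm_apply, dotProduct_comm]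
    exact dotProduct_eq_zero_of_mem_span _ (fun w hw => by rw [dotProduct_comm]; exact h w hw) hw
  · intro h w hw
    rw [← dotForm_apply]
    exact h w (Submodule.subset_span hw)

/-- The Jacobian criterion: the tangent space is the orthogonal complement of the gradients, so
regularity says that their rank is the codimension. -/
theorem mem_regularPoints_iff {Z : Set V} {x : V} :
    x ∈ regularPoints Z ↔ x ∈ Z ∧
      Module.finrank ℂ (Submodule.span ℂ (gradSet (coordIdeal e Z) (e x))) +
        idealDim (coordIdeal e Z) = Fintype.card ι := by
  classical
  have : FiniteDimensional ℂ V := e.symm.finiteDimensional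
  have hT : Module.finrank ℂ (tangentSpace Z x) = Fintype.card ι -
      Module.finrank ℂ (Submodule.span ℂ (gradSet (coordIdeal e Z) (e x))) := by
    rw [← Module.finrank_fintype_fun_eq_card (R := ℂ) (η := ι),
      ← LinearMap.BilinForm.finrank_orthogonal dotForm_nondegenerate, ← map_tangentSpace]
    exact (LinearEquiv.finrank_map_eq e _).symm
  have hle : Module.finrank ℂ (Submodule.span ℂ (gradSet (coordIdeal e Z) (e x))) ≤
      Fintype.card ι := by
    rw [← Module.finrank_fintype_fun_eq_card (R := ℂ) (η := ι)]
    exact Submodule.finrank_le _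
  have hd : dimVariety Z = (idealDim (coordIdeal e Z) : Cardinal) := by
    rw [dimVariety_eq e, idealDim, Cardinal.cast_toNat_of_lt_aleph0 trdeg_lt_aleph0_of_finiteType]
  refine and_congr_right fun _ => ?_
  rw [hd, ← Module.finrank_eq_rank, Nat.cast_inj, hT]
  omega

end Coordinates

/-! ### The conormal and dual varieties -/

section ConormalVariety

variable {V ι : Type} [AddCommGroup V] [Module ℂ V]

/-- Coordinates on a product from coordinates on the factors. -/
noncomputable def pairCoord (e₁ e₂ : V ≃ₗ[ℂ] (ι → ℂ)) : (V × V) ≃ₗ[ℂ] (ι ⊕ ι → ℂ) :=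
  (e₁.prodCongr e₂).trans (LinearEquiv.sumArrowLequivProdArrow ι ι ℂ ℂ).symm

theorem pairCoord_apply (e₁ e₂ : V ≃ₗ[ℂ] (ι → ℂ)) (q : V × V) :
    pairCoord e₁ e₂ q = Sum.elim (e₁ q.1) (e₂ q.2) := by
  ext i
  cases i <;> rfl

variable [Fintype ι] {B : LinearMap.BilinForm ℂ V} {e₁ e₂ : V ≃ₗ[ℂ] (ι → ℂ)}

/-- In coordinates that turn `B` into the dot product, the normal space is the double orthogonal
complement of the span of the gradients. -/
theorem mem_normalSpace_iff (he : ∀ u w, B u w = e₁ u ⬝ᵥ e₂ w) {Z : Set V} {x y : V} :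
    y ∈ normalSpace B Z x ↔ e₂ y ∈ Submodule.span ℂ (gradSet (coordIdeal e₁ Z) (e₁ x)) := by
  classical
  have hrefl : (dotForm ι).IsRefl := fun v w h => by
    rw [dotForm_apply] at h ⊢
    rw [dotProduct_comm, h]
  have h1 := LinearMap.BilinForm.orthogonal_orthogonal dotForm_nondegenerate hrefl
    (Submodule.span ℂ (gradSet (coordIdeal e₁ Z) (e₁ x)))
  rw [← map_tangentSpace] at h1
  rw [← h1, normalSpace, LinearMap.BilinForm.mem_orthogonal_iff,
    LinearMap.BilinForm.mem_orthogonal_iff]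
  constructor
  · rintro h _ ⟨v, hv, rfl⟩
    have := h v hv
    change dotForm ι (e₁ v) (e₂ y) = 0
    rw [dotForm_apply, ← he]
    exact this
  · intro h v hv
    have : dotForm ι (e₁ v) (e₂ y) = 0 := h _ ⟨v, hv, rfl⟩
    rw [dotForm_apply, ← he] at this
    exact this

/-- The regular points of an irreducible variety contain a nonempty open subset. -/
theorem exists_notMem_regularPoints (e : V ≃ₗ[ℂ] (ι → ℂ)) {Z : Set V}
    (hZ : (vanishing Z).IsPrime) :
    ∃ h ∉ coordIdeal e Z, ∀ x ∈ Z, aeval (e x) h ≠ 0 → x ∈ regularPoints Z := by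
  have := coordIdeal_isPrime e hZ
  obtain ⟨h, hh, H⟩ := exists_notMem_forall_le_finrank (coordIdeal e Z)
  refine ⟨h, hh, fun x hx hxh => (mem_regularPoints_iff e).2 ⟨hx, le_antisymm ?_ (H _ hxh)⟩⟩
  exact finrank_span_gradSet_add_idealDim_le _ _ fun f hf => hf x hx

theorem coordIdeal_conormal (he : ∀ u w, B u w = e₁ u ⬝ᵥ e₂ w) {Z : Set V}
    (hZ : (vanishing Z).IsPrime) :
    coordIdeal (pairCoord e₁ e₂) (conormal B Z) = conormalIdeal (coordIdeal e₁ Z) := by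
  have := coordIdeal_isPrime e₁ hZ
  rw [conormal, coordIdeal_zariskiClosure]
  ext F
  constructor
  · intro hF w hw
    obtain ⟨h, hh, H⟩ := exists_notMem_regularPoints e₁ hZ
    -- `F` is known to vanish only over regular points. The factor `h` covers the others and is then
    -- cancelled by primality.
    have h1 : h * aeval (Sum.elim X w) F ∈ coordIdeal e₁ Z := by
      intro x hx
      rw [map_mul]
      by_cases hxh : aeval (e₁ x) h = 0
      · rw [hxh, zero_mul]
      · have h2 := hF (x, e₂.symm fun i => aeval (e₁ x) (w i)) ⟨H x hx hxh, by
          rw [mem_normalSpace_iff he, LinearEquiv.apply_symm_apply]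
          exact aeval_mem_span_of_mem_gradModule _ hw⟩
        rw [pairCoord_apply, LinearEquiv.apply_symm_apply] at h2
        rw [aeval_aeval_sumElim, h2, mul_zero]
    exact (this.mem_or_mem h1).resolve_left hh
  · rintro hF ⟨x, y⟩ ⟨hx, hy⟩
    rw [mem_normalSpace_iff he] at hy
    obtain ⟨w, hw, hw'⟩ := exists_mem_gradModule_of_mem_span _ hy
    rw [pairCoord_apply, hw', ← aeval_aeval_sumElim]
    exact hF w hw x hx.1

theorem mem_conormal_iff (he : ∀ u w, B u w = e₁ u ⬝ᵥ e₂ w) {Z : Set V}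
    (hZ : (vanishing Z).IsPrime) {q : V × V} :
    q ∈ conormal B Z ↔
      ∀ F ∈ conormalIdeal (coordIdeal e₁ Z), aeval (Sum.elim (e₁ q.1) (e₂ q.2)) F = 0 := by
  rw [← coordIdeal_conormal he hZ, conormal, mem_zariskiClosure_iff (pairCoord e₁ e₂),
    coordIdeal_zariskiClosure, pairCoord_apply]

theorem coordIdeal_dualVariety (he : ∀ u w, B u w = e₁ u ⬝ᵥ e₂ w) {Z : Set V}
    (hZ : (vanishing Z).IsPrime) :
    coordIdeal e₂ (dualVariety B Z) = dualIdeal (coordIdeal e₁ Z) := by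
  rw [dualVariety, coordIdeal_zariskiClosure, dualIdeal, ← coordIdeal_conormal he hZ]
  ext f
  constructor
  · intro hf q hq
    rw [pairCoord_apply]
    change aeval _ (rename _ f) = 0
    rw [aeval_sumElim_rename_inr]
    exact hf _ ⟨q, hq, rfl⟩
  · rintro hf _ ⟨q, hq, rfl⟩
    rw [← aeval_sumElim_rename_inr (e₁ q.1), ← pairCoord_apply]
    exact hf q hq

theorem exists_dual_coordinates [FiniteDimensional ℂ V] (hB : B.Nondegenerate) :
    ∃ e₁ e₂ : V ≃ₗ[ℂ] (Fin (Module.finrank ℂ V) → ℂ), ∀ u w, B u w = e₁ u ⬝ᵥ e₂ w := by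
  let b := Module.finBasis ℂ V
  let φ : V →ₗ[ℂ] (Fin (Module.finrank ℂ V) → ℂ) := LinearMap.pi fun i => B (b i)
  have h1 : ∀ u w, B u w = b.equivFun u ⬝ᵥ φ w := fun u w => by
    conv_lhs => rw [← b.sum_equivFun u]
    simp only [map_sum, map_smul, LinearMap.sum_apply, LinearMap.smul_apply, smul_eq_mul]
    rfl
  have hφ : Function.Injective φ := by
    rw [injective_iff_map_eq_zero]
    intro w hw
    exact hB.2 w fun u => by rw [h1, hw, dotProduct_zero]
  exact ⟨b.equivFun, φ.linearEquivOfInjective hφ (by simp), h1⟩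

variable [FiniteDimensional ℂ V] {Z : Set V}

/-- Biduality: the conormal varieties of an irreducible cone and of its dual variety agree up to
the exchange of the factors. -/
theorem mem_conormal_dualVariety_iff (hB : B.Nondegenerate) (hsymm : ∀ u w, B u w = B w u)
    (hZ : (vanishing Z).IsPrime) (hcone : ∀ c : ℂ, ∀ z ∈ Z, c • z ∈ Z) {x y : V} :
    (y, x) ∈ conormal B (dualVariety B Z) ↔ (x, y) ∈ conormal B Z := by
  obtain ⟨e₁, e₂, he⟩ := exists_dual_coordinates hB
  have := coordIdeal_isPrime e₁ hZ
  -- By symmetry of `B` the two coordinate systems can trade roles, as required since the dual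
  -- variety is described in `e₂`.
  have he' : ∀ u w, B u w = e₂ u ⬝ᵥ e₁ w := fun u w => by rw [hsymm, he, dotProduct_comm]
  have hd := coordIdeal_dualVariety he hZ
  have hZ' : (vanishing (dualVariety B Z)).IsPrime := by
    have h1 := dualIdeal_isPrime (coordIdeal e₁ Z)
    rw [← hd, coordIdeal_eq_comap] at h1
    have h2 := Ideal.map_isPrime_of_equiv (polyFunEquiv e₂)
      (I := (vanishing (dualVariety B Z)).comap (polyFunEquiv e₂))
    rwa [Ideal.map_comap_of_surjective _ (polyFunEquiv e₂).surjective] at h2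
  rw [mem_conormal_iff he' hZ', mem_conormal_iff he hZ, hd,
    conormalIdeal_dualIdeal _ (sum_X_mul_grad_mem_coordIdeal e₁ hcone)]
  constructor
  · intro h F hF
    have h1 := h (rename Sum.swap F) (by
      change rename Sum.swap (rename Sum.swap F) ∈ conormalIdeal (coordIdeal e₁ Z)
      rw [rename_rename]
      have : (Sum.swap ∘ Sum.swap : Fin (Module.finrank ℂ V) ⊕ Fin (Module.finrank ℂ V) → _) = id :=
        _root_.funext Sum.swap_swap
      rwa [this, rename_id_apply])
    rwa [aeval_sumElim_rename_swap] at h1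
  · intro h F hF
    have h1 := h _ hF
    rwa [aeval_sumElim_rename_swap] at h1

/-- Over a regular point the fibre of the conormal variety is the normal space. -/
theorem mem_normalSpace_of_mem_conormal (hB : B.Nondegenerate) (hZ : (vanishing Z).IsPrime)
    {x y : V} (hx : x ∈ regularPoints Z) (h : (x, y) ∈ conormal B Z) :
    y ∈ normalSpace B Z x := by
  obtain ⟨e₁, e₂, he⟩ := exists_dual_coordinates hB
  have := coordIdeal_isPrime e₁ hZ
  rw [mem_normalSpace_iff he]
  have h1 := ((mem_regularPoints_iff e₁).1 hx).2
  have h2 := (mem_conormal_iff he hZ).1 h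
  exact mem_span_gradSet_of_conormalIdeal (coordIdeal e₁ Z) (e₁ x) (e₂ y) h1 h2

end ConormalVariety

/-! ### Data loci of smooth cones, and tools for regularity and irreducibility -/

section DataLocus

variable {V W : Type} [AddCommGroup V] [Module ℂ V] [AddCommGroup W] [Module ℂ W]

theorem subset_zariskiClosure (S : Set V) : S ⊆ zariskiClosure S := fun v hv _ hf => hf v hv

theorem zariskiClosure_subset {S T : Set V} (h : S ⊆ zariskiClosure T) :
    zariskiClosure S ⊆ zariskiClosure T := fun _ hv f hf => hv f fun _ hw => h hw f hf

theorem polyFun_comp_linearMap (φ : V →ₗ[ℂ] W) {f : W → ℂ} (hf : f ∈ polyFun W) :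
    (fun v => f (φ v)) ∈ polyFun V := by
  induction hf using Algebra.adjoin_induction with
  | mem f hf =>
    obtain ⟨ψ, rfl⟩ := hf
    exact Algebra.subset_adjoin ⟨ψ ∘ₗ φ, rfl⟩
  | algebraMap r => exact (polyFun V).algebraMap_mem r
  | add f g _ _ hf hg => exact (polyFun V).add_mem hf hg
  | mul f g _ _ hf hg => exact (polyFun V).mul_mem hf hg

theorem map_mem_zariskiClosure (φ : V →ₗ[ℂ] W) {S : Set V} {T : Set W}
    (h : ∀ v ∈ S, φ v ∈ zariskiClosure T) {v : V} (hv : v ∈ zariskiClosure S) :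
    φ v ∈ zariskiClosure T := fun f hf =>
  hv ⟨_, polyFun_comp_linearMap φ f.2⟩ fun w hw => h w hw f hf

theorem eq_zero_of_mem_zariskiClosure (φ : V →ₗ[ℂ] W) {S : Set V} (h : ∀ v ∈ S, φ v = 0)
    {v : V} (hv : v ∈ zariskiClosure S) : φ v = 0 := by
  refine (Module.forall_dual_apply_eq_zero_iff ℂ _).1 fun ψ => ?_
  exact hv ⟨_, Algebra.subset_adjoin ⟨ψ ∘ₗ φ, rfl⟩⟩ fun w hw => by simp [h w hw]

/-- The closure adds nothing: `Con(Z)` is closed and `T = x + y` is a linear condition. -/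
theorem mem_jointED_iff {B : LinearMap.BilinForm ℂ V} {Z : Set V} {t : V × V × V} :
    t ∈ jointED B Z ↔ (t.1, t.2.1) ∈ conormal B Z ∧ t.2.2 = t.1 + t.2.1 := by
  refine ⟨fun h => ⟨?_, ?_⟩, fun h => subset_zariskiClosure _ h⟩
  · exact map_mem_zariskiClosure
      ((LinearMap.fst ℂ V (V × V)).prod (LinearMap.fst ℂ V V ∘ₗ LinearMap.snd ℂ V (V × V)))
      (fun v hv => hv.1) h
  · have h1 := eq_zero_of_mem_zariskiClosure
      (LinearMap.snd ℂ V V ∘ₗ LinearMap.snd ℂ V (V × V) - (LinearMap.fst ℂ V (V × V) +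
        LinearMap.fst ℂ V V ∘ₗ LinearMap.snd ℂ V (V × V)))
      (fun v hv => by simp [hv.2]) h
    exact sub_eq_zero.1 h1

theorem zero_mem_zariskiClosure_of_smul_mem {S : Set V} {z : V}
    (h : ∀ c : ℂ, c ≠ 0 → c • z ∈ S) : (0 : V) ∈ zariskiClosure S := by
  intro f hf
  obtain ⟨L, hL⟩ := polyFun_hasLineDerivAt f.2 (0 : V)
  have h1 : ContinuousAt (fun t : ℂ => (f : V → ℂ) (0 + t • z)) 0 :=
    HasDerivAt.continuousAt (hL z)
  have h2 : Filter.Tendsto (fun t : ℂ => (f : V → ℂ) (0 + t • z)) (nhdsWithin 0 {0}ᶜ)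
      (nhds ((f : V → ℂ) (0 + (0 : ℂ) • z))) := h1.tendsto.mono_left nhdsWithin_le_nhds
  have h3 : Filter.Tendsto (fun t : ℂ => (f : V → ℂ) (0 + t • z)) (nhdsWithin 0 {0}ᶜ)
      (nhds 0) := by
    refine tendsto_const_nhds.congr' ?_
    filter_upwards [self_mem_nhdsWithin] with t ht
    rw [zero_add]
    exact (hf _ (h t ht)).symm
  simpa using tendsto_nhds_unique h2 h3

/-- The data locus of `Z ∩ Z*` with respect to the dual variety `Z*` of an irreducible cone `Z`
that is regular outside the origin. -/
theorem dataLocus_dualVariety [FiniteDimensional ℂ V] {B : LinearMap.BilinForm ℂ V} {Z : Set V}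
    (hB : B.Nondegenerate) (hsymm : ∀ u w, B u w = B w u)
    (hclosed : zariskiClosure Z ⊆ Z) (hZ : (vanishing Z).IsPrime)
    (hcone : ∀ c : ℂ, ∀ z ∈ Z, c • z ∈ Z) (hreg : ∀ z ∈ Z, z ≠ 0 → z ∈ regularPoints Z) :
    dataLocus B (dualVariety B Z) (Z ∩ dualVariety B Z) =
      zariskiClosure {T | ∃ x ∈ regularPoints Z, ∃ y, y ∈ normalSpace B Z x ∧ y ∈ Z ∧
        T = x + y} := by
  refine Set.Subset.antisymm (zariskiClosure_subset ?_) (zariskiClosure_subset ?_)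
  · rintro _ ⟨⟨x, y, T⟩, ⟨ht, hx, -⟩, rfl⟩
    obtain ⟨hxy, hT⟩ := mem_jointED_iff.1 ht
    simp only at hx hxy hT ⊢
    subst hT
    rw [mem_conormal_dualVariety_iff hB hsymm hZ hcone] at hxy
    have hy : y ∈ Z := hclosed (map_mem_zariskiClosure (LinearMap.fst ℂ V V)
      (fun q hq => subset_zariskiClosure _ hq.1.1) hxy)
    by_cases hy0 : y = 0
    · subst hy0
      -- For `x = y = 0` the origin may be singular. It is then reached as a limit of nonzero
      -- multiples `c • z`, which are regular and have normal vector `0`.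
      by_cases hx0 : x = 0
      · subst hx0
        obtain ⟨e, -⟩ := exists_dual_coordinates hB
        obtain ⟨h, hh, H⟩ := exists_notMem_regularPoints e hZ
        rw [mem_coordIdeal] at hh
        push Not at hh
        obtain ⟨z, hz, hzh⟩ := hh
        rw [add_zero]
        by_cases hz0 : z = 0
        · subst hz0
          exact subset_zariskiClosure _ ⟨0, H _ hz hzh, 0, Submodule.zero_mem _, hy, by simp⟩
        · refine zero_mem_zariskiClosure_of_smul_mem (z := z) fun c hc => ?_
          exact ⟨c • z, hreg _ (hcone c z hz) (smul_ne_zero hc hz0), 0, Submodule.zero_mem _, hy,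
            by simp⟩
      · exact subset_zariskiClosure _ ⟨x, hreg x hx hx0, 0, Submodule.zero_mem _, hy, rfl⟩
    -- The roles are exchanged here: `y` is the regular point and `x` the normal vector.
    · have hyr := hreg y hy hy0
      exact subset_zariskiClosure _ ⟨y, hyr, x, mem_normalSpace_of_mem_conormal hB hZ hyr hxy, hx,
        add_comm _ _⟩
  · rintro _ ⟨x, hx, y, hy, hyZ, rfl⟩
    have hxy : (x, y) ∈ conormal B Z := subset_zariskiClosure _ ⟨hx, hy⟩
    refine subset_zariskiClosure _ ⟨(y, x, y + x), ⟨mem_jointED_iff.2 ⟨?_, rfl⟩, hyZ, ?_⟩,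
      add_comm _ _⟩
    · exact (mem_conormal_dualVariety_iff hB hsymm hZ hcone).2 hxy
    · exact subset_zariskiClosure _ ⟨(x, y), hxy, rfl⟩

theorem map_mem_tangentSpace {Z : Set V} (g : V →ₗ[ℂ] V) (hg : ∀ z ∈ Z, g z ∈ Z) {x v : V}
    (hv : v ∈ tangentSpace Z x) : g v ∈ tangentSpace Z (g x) := by
  intro f hf
  have h1 := hv ⟨_, polyFun_comp_linearMap g f.2⟩ fun z hz => hf _ (hg z hz)
  rw [← h1]
  simp [lineDeriv]

/-- Linear automorphisms of a variety preserve its regular points. -/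
theorem map_mem_regularPoints {Z : Set V} (g : V ≃ₗ[ℂ] V) (hg : ∀ z ∈ Z, g z ∈ Z)
    (hg' : ∀ z ∈ Z, g.symm z ∈ Z) {x : V} (hx : x ∈ regularPoints Z) : g x ∈ regularPoints Z := by
  refine ⟨hg x hx.1, ?_⟩
  rw [← hx.2]
  have h1 : ∀ (g : V ≃ₗ[ℂ] V), (∀ z ∈ Z, g z ∈ Z) → ∀ x,
      Module.rank ℂ (tangentSpace Z x) ≤ Module.rank ℂ (tangentSpace Z (g x)) := fun g hg x =>
    LinearMap.rank_le_of_injective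
      ((g : V →ₗ[ℂ] V).restrict fun v hv => map_mem_tangentSpace (g : V →ₗ[ℂ] V) hg hv)
      fun a b h => Subtype.ext (g.injective (congr_arg Subtype.val h))
  refine le_antisymm ?_ (h1 g hg x)
  have h2 := h1 g.symm hg' (g x)
  rwa [LinearEquiv.symm_apply_apply] at h2

/-- The image of a vector space under a polynomial map is irreducible. -/
theorem vanishing_range_isPrime {E : Type} {κ : Type} [AddCommGroup E] [Module ℂ E] [Fintype κ]
    (e : E ≃ₗ[ℂ] (κ → ℂ)) (φ : E → V)
    (hφ : ∀ ψ : Module.Dual ℂ V, (fun u => ψ (φ u)) ∈ polyFun E) :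
    (vanishing (Set.range φ)).IsPrime := by
  have hcomp : ∀ f ∈ polyFun V, (fun u => f (φ u)) ∈ polyFun E := fun f hf => by
    induction hf using Algebra.adjoin_induction with
    | mem f hf => obtain ⟨ψ, rfl⟩ := hf; exact hφ ψ
    | algebraMap r => exact (polyFun E).algebraMap_mem r
    | add f g _ _ hf hg => exact (polyFun E).add_mem hf hg
    | mul f g _ _ hf hg => exact (polyFun E).mul_mem hf hg
  have : IsDomain (polyFun E) := (polyFunEquiv e).symm.toMulEquiv.isDomain _
  let F : polyFun V →+* polyFun E :=
    { toFun := fun f => ⟨_, hcomp f.1 f.2⟩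
      map_one' := rfl
      map_mul' := fun _ _ => rfl
      map_zero' := rfl
      map_add' := fun _ _ => rfl }
  have h : vanishing (Set.range φ) = RingHom.ker F := by
    ext f
    rw [RingHom.mem_ker]
    constructor
    · intro hf
      exact Subtype.ext (_root_.funext fun u => hf _ ⟨u, rfl⟩)
    · rintro hf _ ⟨u, rfl⟩
      exact congr_fun (congr_arg Subtype.val hf) u
  rw [h]
  exact RingHom.ker_isPrime _

end DataLocus

/-! ### The Bombieri-Weyl form and the variety of rank-one tensors -/

section RankOne

variable {p : ℕ} {n : Fin p → ℕ}

theorem bwForm_symm (G : (i : Fin p) → Matrix (Fin (n i)) (Fin (n i)) ℝ)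
    (hG : ∀ i, (G i).PosDef) (u w : TensorSpace n) : bwForm G u w = bwForm G w u := by
  have h : bwForm G = (bwForm G).flip := by
    refine PiTensorProduct.ext (MultilinearMap.ext fun x => ?_)
    refine PiTensorProduct.ext (MultilinearMap.ext fun y => ?_)
    change bwForm G (PiTensorProduct.tprod ℂ x) (PiTensorProduct.tprod ℂ y) =
      bwForm G (PiTensorProduct.tprod ℂ y) (PiTensorProduct.tprod ℂ x)
    rw [bwForm_tprod, bwForm_tprod]
    refine Finset.prod_congr rfl fun i _ => ?_
    rw [Finset.sum_comm]
    refine Finset.sum_congr rfl fun a _ => Finset.sum_congr rfl fun b _ => ?_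
    have hs : G i b a = G i a b := by simpa using (hG i).isHermitian.apply a b
    rw [hs]
    ring
  conv_lhs => rw [h]
  rfl

/-- Each factor gives an isomorphism with its dual because its Gram determinant is positive, hence
nonzero over `ℂ`; the form is the tensor product of these isomorphisms. -/
theorem bwForm_nondegenerate (G : (i : Fin p) → Matrix (Fin (n i)) (Fin (n i)) ℝ)
    (hG : ∀ i, (G i).PosDef) : (bwForm G).Nondegenerate := by
  have hdet : ∀ i, ((G i).map Complex.ofReal).det ≠ 0 := fun i => by
    have : ((G i).map Complex.ofReal).det = ((G i).det : ℂ) :=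
      (RingHom.map_det Complex.ofRealHom (G i)).symm
    rw [this]
    exact_mod_cast (hG i).det_pos.ne'
  have hnd : ∀ i, (Matrix.toBilin' ((G i).map Complex.ofReal)).Nondegenerate := fun i =>
    LinearMap.BilinForm.nondegenerate_toBilin'_of_det_ne_zero' _ (hdet i)
  let E := (PiTensorProduct.congr fun i =>
    LinearMap.BilinForm.toDual (Matrix.toBilin' ((G i).map Complex.ofReal)) (hnd i)).trans
      (PiTensorProduct.dualDistribEquiv (R := ℂ) (M := fun i => Fin (n i) → ℂ))
  have hE : ∀ u, bwForm G u = E u := fun u => by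
    have : bwForm G = E.toLinearMap := by
      refine PiTensorProduct.ext (MultilinearMap.ext fun x => ?_)
      refine PiTensorProduct.ext (MultilinearMap.ext fun y => ?_)
      simp [bwForm, E, PiTensorProduct.dualDistribEquivOfBasis_apply_apply,
        LinearMap.BilinForm.toDual_def]
      congr!
    rw [this]
    rfl
  have hl : (bwForm G).SeparatingLeft := fun u hu => by
    apply E.injective
    rw [← hE, map_zero]
    exact LinearMap.ext hu
  exact ⟨hl, fun u hu => hl u fun w => by rw [bwForm_symm G hG]; exact hu w⟩

/-- The scalar is absorbed by one factor. For `p = 0` there is none: the only pure tensor is then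
the empty one. -/
theorem smul_mem_rankOne (hp : 0 < p) (c : ℂ) {z : TensorSpace n} (hz : z ∈ rankOne n) :
    c • z ∈ rankOne n := by
  obtain ⟨v, rfl⟩ := hz
  refine ⟨Function.update v ⟨0, hp⟩ (c • v ⟨0, hp⟩), ?_⟩
  simp only
  rw [MultilinearMap.map_update_smul, Function.update_eq_self]

/-- Coordinates of tensors with respect to the standard basis. -/
noncomputable def tensorBasis (n : Fin p → ℕ) :
    Module.Basis ((i : Fin p) → Fin (n i)) ℂ (TensorSpace n) :=
  Basis.piTensorProduct fun i => Pi.basisFun ℂ (Fin (n i))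

theorem tensorBasis_repr_tprod (v : (i : Fin p) → Fin (n i) → ℂ) (a : (i : Fin p) → Fin (n i)) :
    (tensorBasis n).repr (PiTensorProduct.tprod ℂ v) a = ∏ i, v i (a i) := by
  rw [tensorBasis, Basis.piTensorProduct_repr_tprod_apply]
  simp

theorem vanishing_rankOne_isPrime : (vanishing (rankOne n)).IsPrime := by
  refine vanishing_range_isPrime
    (LinearEquiv.piCurry ℂ (fun (i : Fin p) (_ : Fin (n i)) => ℂ)).symm _ fun ψ => ?_
  have h : (fun v : (i : Fin p) → Fin (n i) → ℂ => ψ (PiTensorProduct.tprod ℂ v)) =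
      ∑ a : (i : Fin p) → Fin (n i), (ψ (tensorBasis n a)) • ∏ i,
        fun v : (i : Fin p) → Fin (n i) → ℂ => v i (a i) := by
    ext v
    conv_lhs => rw [← (tensorBasis n).sum_repr (PiTensorProduct.tprod ℂ v), map_sum]
    simp [tensorBasis_repr_tprod, Finset.sum_apply, mul_comm]
  rw [h]
  refine Subalgebra.sum_mem _ fun a _ => Subalgebra.smul_mem _ (Subalgebra.prod_mem _ fun i _ => ?_) _
  exact Algebra.subset_adjoin ⟨LinearMap.proj (a i) ∘ₗ LinearMap.proj i, rfl⟩

theorem repr_mem_polyFun (a : (i : Fin p) → Fin (n i)) :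
    (fun t => (tensorBasis n).repr t a) ∈ polyFun (TensorSpace n) :=
  Algebra.subset_adjoin ⟨(tensorBasis n).coord a, rfl⟩

/-- The exchange relations between the coordinates of a tensor of rank at most one hold on the
Zariski closure. -/
theorem repr_mul_repr_of_mem_closure {t : TensorSpace n} (ht : t ∈ zariskiClosure (rankOne n))
    (a b : (i : Fin p) → Fin (n i)) (i : Fin p) :
    (tensorBasis n).repr t a * (tensorBasis n).repr t b =
      (tensorBasis n).repr t (Function.update a i (b i)) *
        (tensorBasis n).repr t (Function.update b i (a i)) := by
  have h := ht ⟨_, (polyFun (TensorSpace n)).sub_mem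
    ((polyFun _).mul_mem (repr_mem_polyFun a) (repr_mem_polyFun b))
    ((polyFun _).mul_mem (repr_mem_polyFun (Function.update a i (b i)))
      (repr_mem_polyFun (Function.update b i (a i))))⟩ (by
      rintro _ ⟨v, rfl⟩
      simp only [Pi.sub_apply, Pi.mul_apply, tensorBasis_repr_tprod, sub_eq_zero,
        ← Finset.prod_mul_distrib]
      refine Finset.prod_congr rfl fun j _ => ?_
      by_cases hj : j = i
      · subst hj; simp [mul_comm]
      · simp [Function.update_of_ne hj])
  exact sub_eq_zero.1 h

theorem zariskiClosure_rankOne_subset (hp : 0 < p) :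
    zariskiClosure (rankOne n) ⊆ rankOne n := by
  classical
  intro t ht
  by_cases ht0 : t = 0
  · subst ht0
    exact ⟨0, (PiTensorProduct.tprod ℂ).map_coord_zero ⟨0, hp⟩ rfl⟩
  obtain ⟨a, ha⟩ : ∃ a, (tensorBasis n).repr t a ≠ 0 := by
    by_contra! h
    exact ht0 ((tensorBasis n).ext_elem fun a => by simp [h a])
  set τ := fun a => (tensorBasis n).repr t a with hτ
  -- The entries of the multi-index `a` are replaced by those of `b` one at a time, each by an
  -- exchange relation.
  have key : ∀ (b : (i : Fin p) → Fin (n i)) (s : Finset (Fin p)),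
      τ (s.piecewise b a) * τ a ^ s.card = τ a * ∏ i ∈ s, τ (Function.update a i (b i)) := by
    intro b s
    induction s using Finset.induction_on with
    | empty => simp
    | insert i s hi ih =>
      have h1 := repr_mul_repr_of_mem_closure ht (Function.update (s.piecewise b a) i (b i)) a i
      have h2 : Function.update (Function.update (s.piecewise b a) i (b i)) i (a i) =
          s.piecewise b a := by
        rw [Function.update_idem]
        conv_rhs => rw [← Function.update_eq_self i (s.piecewise b a)]
        rw [Finset.piecewise_eq_of_notMem _ _ _ hi]
      rw [h2, Function.update_self] at h1
      rw [Finset.piecewise_insert, Finset.card_insert_of_notMem hi, Finset.prod_insert hi, pow_succ]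
      calc _ = (τ (Function.update (s.piecewise b a) i (b i)) * τ a) * τ a ^ s.card := by ring
        _ = (τ (s.piecewise b a) * τ (Function.update a i (b i))) * τ a ^ s.card :=
          congr_arg (· * τ a ^ s.card) h1
        _ = (τ (s.piecewise b a) * τ a ^ s.card) * τ (Function.update a i (b i)) := by ring
        _ = _ := by rw [ih]; ring
  -- The factors are read off the lines of entries of `t` through the nonzero entry `a`.
  have h : t = τ a • PiTensorProduct.tprod ℂ fun i j => τ (Function.update a i j) / τ a := by
    refine (tensorBasis n).ext_elem fun b => ?_
    have h1 := key b Finset.univ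
    rw [Finset.piecewise_univ] at h1
    rw [map_smul, Finsupp.smul_apply, tensorBasis_repr_tprod, Finset.prod_div_distrib,
      Finset.prod_const, smul_eq_mul, ← mul_div_assoc, ← h1, mul_div_cancel_right₀ _ (pow_ne_zero _ ha)]
  rw [h]
  exact smul_mem_rankOne hp _ ⟨_, rfl⟩

theorem exists_linearEquiv_apply_eq {m : ℕ} {v w : Fin m → ℂ} (hv : v ≠ 0) (hw : w ≠ 0) :
    ∃ g : (Fin m → ℂ) ≃ₗ[ℂ] (Fin m → ℂ), g v = w := by
  obtain ⟨g, hg⟩ := SeparatingDual.exists_continuousLinearEquiv_apply_eq (R := ℂ) hv hw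
  exact ⟨g.toLinearEquiv, hg⟩

/-- The variety of tensors of rank at most one is regular outside the origin. -/
theorem mem_regularPoints_rankOne {z : TensorSpace n} (hz : z ∈ rankOne n) (hz0 : z ≠ 0) :
    z ∈ regularPoints (rankOne n) := by
  have hprime := vanishing_rankOne_isPrime (n := n)
  have e := (tensorBasis n).equivFun
  have hI := coordIdeal_isPrime e hprime
  obtain ⟨h, hh, H⟩ := exists_notMem_regularPoints e hprime
  -- Neither `h` nor a coordinate that is nonzero at `z` lies in the prime ideal, so some point of
  -- `X` avoids both zero sets; it is regular and nonzero.
  obtain ⟨x, hx, hx0⟩ : ∃ x ∈ regularPoints (rankOne n), x ≠ 0 := by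
    obtain ⟨i, hi⟩ : ∃ i, e z i ≠ 0 := by
      by_contra! h0
      exact hz0 (e.injective (by rw [map_zero]; exact funext h0))
    have h1 : h * X i ∉ coordIdeal e (rankOne n) := fun hmem =>
      (hI.mem_or_mem hmem).elim hh fun hX => hi (by simpa using hX z hz)
    rw [mem_coordIdeal] at h1
    push Not at h1
    obtain ⟨x, hx, hxh⟩ := h1
    rw [map_mul, aeval_X] at hxh
    refine ⟨x, H x hx (left_ne_zero_of_mul hxh), ?_⟩
    rintro rfl
    simp at hxh
  obtain ⟨v, rfl⟩ := hz
  obtain ⟨⟨u, rfl⟩, -⟩ := id hx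
  have hne : ∀ {w : (i : Fin p) → Fin (n i) → ℂ}, PiTensorProduct.tprod ℂ w ≠ 0 → ∀ i, w i ≠ 0 :=
    fun hw i hi => hw ((PiTensorProduct.tprod ℂ).map_coord_zero i hi)
  -- Products of linear automorphisms of the factors preserve `X` and act transitively on its
  -- nonzero points, so regularity spreads from one such point to all.
  choose g hg using fun i => exists_linearEquiv_apply_eq (hne hx0 i) (hne hz0 i)
  have hmap : ∀ (g : (i : Fin p) → (Fin (n i) → ℂ) ≃ₗ[ℂ] (Fin (n i) → ℂ)),
      ∀ z ∈ rankOne n, PiTensorProduct.congr g z ∈ rankOne n := by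
    rintro g _ ⟨w, rfl⟩
    exact ⟨fun i => g i (w i), (PiTensorProduct.congr_tprod g w).symm⟩
  have h2 := map_mem_regularPoints (PiTensorProduct.congr g) (hmap g)
    (by
      rintro _ ⟨w, rfl⟩
      exact ⟨fun i => (g i).symm (w i), (PiTensorProduct.congr_symm_tprod g w).symm⟩) hx
  simp only [PiTensorProduct.congr_tprod, hg] at h2
  exact h2

end RankOne

end TensorDL

/-! ### The data locus of rank-one tensors -/

theorem mainTheorem4 {p : ℕ} (hp : 0 < p) (n : Fin p → ℕ)
    (G : (i : Fin p) → Matrix (Fin (n i)) (Fin (n i)) ℝ) (hG : ∀ i, (G i).PosDef) :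
    TensorDL.DL2 G =
      TensorDL.zariskiClosure
        {T : TensorDL.TensorSpace n |
          ∃ x ∈ TensorDL.regularPoints (TensorDL.rankOne n),
            ∃ y, y ∈ TensorDL.normalSpace (TensorDL.bwForm G) (TensorDL.rankOne n) x ∧
              y ∈ TensorDL.rankOne n ∧ T = x + y} := by
  have : FiniteDimensional ℂ (TensorDL.TensorSpace n) :=
    (TensorDL.tensorBasis n).finiteDimensional_of_finite
  exact TensorDL.dataLocus_dualVariety (TensorDL.bwForm_nondegenerate G hG)
    (TensorDL.bwForm_symm G hG) (TensorDL.zariskiClosure_rankOne_subset hp)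
    TensorDL.vanishing_rankOne_isPrime (fun c _ hz => TensorDL.smul_mem_rankOne hp c hz)
    fun _ hz hz0 => TensorDL.mem_regularPoints_rankOne hz hz0
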